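/- Let $X$ be an oriented smooth four-manifold with a Riemannian metric. *Conventions.* The metric gives $\Lambda^2=\Lambda^2T^*X$ the inner product for which the forms $e_i\wedge e_j$ ($i<j$) are orthonormal when $(e_i)$ is an oriented orthonormal coframe; $\Lambda^2=\Lambda^+\oplus\Lambda^-$ is the splitting into self-dual and anti-self-dual forms. Let $R(u,v)=[\nabla_u,\nabla_v]-\nabla_{[u,v]}$ be the curvature of the Levi-Civita connection, $s$ the scalar curvature, $\mathrm{ric}_0$ the trace-free Ricci tensor viewed as a symmetric endomorphism, and let $\mathrm{Rm}:\Lambda^2\to\Lambda^2$ be the curvature operator, normalised to be the identity on the unit sphere. Put $\mathrm{Ric}_0(a\wedge b)=\tfrac12(\mathrm{ric}_0 a\wedge b+a\wedge \mathrm{ric}_0 b)$, which interchanges $\Lambda^+$ and $\Lambda^-$; below $\mathrm{Ric}_0$ denotes its restriction $\Lambda^+\to\Lambda^-$ and $\mathrm{Ric}_0^*:\Lambda^-\to\Lambda^+$ its adjoint. Let $W^+:\Lambda^+\to\Lambda^+$ be the self-dual part of the Weyl operator, so that $W^++\frac s{12}$ is the $\Lambda^+\to\Lambda^+$ block of $\mathrm{Rm}$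 and $\mathrm{Ric}_0$ its $\Lambda^+\to\Lambda^-$ block. Define the self-adjoint operator $$\mathcal D=\Big(W^++\frac s{12}\Big)^2-\mathrm{Ric}_0^*\,\mathrm{Ric}_0:\Lambda^+\to\Lambda^+ .$$ *Definite connections.* Let $\nabla$ be a metric connection on an oriented Euclidean rank-three bundle $E\to X$ with curvature $F\in\Lambda^2\otimes\mathfrak{so}(E)$, regarded as a map $F:\mathfrak{so}(E)^*\to\Lambda^2$. The connection is *definite at* $x$ if the image of $F_x$ is a maximal subspace of $\Lambda^2T_x^*X$ among those on which the wedge-square $\theta\mapsto\theta\wedge\theta$ is definite, and *definite* if it is so at every point. When this holds at $x$, the connection induces the orientation of $T_xX$ for which the Pontrjagin form $-\mathrm{tr}(F\wedge F)$ is positive, and the conformal class of metrics on $T_xX$ for which (in this orientation) the image of $F_x$ is the space of self-dual forms. The Lie algebra of an $\mathrm{SO}(3)$ is oriented by declaring $\xi,\eta,[\xi,\eta]$ positive for linearly independent $\xi,\eta$; for any orientation and metric on $T_xX$ the spaces $\Lambda^\pm$ are oriented in this way as the two summands of $\Lambda^2\cong\mathfrak{so}(TX)=\mathfrak{so}(3)\oplus\mathfrak{so}(3)$.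 The *sign* of the connection at $x$ is positive or negative according to whether $F_x:\mathfrak{so}(E)_x^*\to \mathrm{im}\,F_x$ preserves or reverses orientation, where $\mathfrak{so}(E)^*\cong\mathfrak{so}(E)$ by the invariant inner product and $\mathrm{im}\,F_x$ is oriented as the space of self-dual forms of the induced orientation and conformal class. **Theorem.** The connection on $\Lambda^+$ induced by the Levi-Civita connection is definite at a point $x$ if and only if $\mathcal D_x$ is (positive or negative) definite; hence it is a definite connection if and only if $\mathcal D$ is definite at every point. Moreover: 1. At each point where $\mathcal D>0$, the connection induces the original orientation of $X$, $\det(W^++\frac s{12})\neq0$, and the sign of the connection is the sign of $\det(W^++\frac s{12})$. 2. At each point where $\mathcal D<0$, the connection induces the opposite orientation of $X$, $\det \mathrm{Ric}_0\neq0$, and the sign of the connection is the sign of $\det \mathrm{Ric}_0$, where the determinant of $\mathrm{Ric}_0:\Lambda^+\to\Lambda^-$ is taken with respect to the natural orientations and the metrics of $\Lambda^\pm$. -/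

import Mathlib

set_option maxSynthPendingDepth 3

open Bundle Module
open scoped Manifold Topology

namespace DefConn

noncomputable section

/-- The model space `ℝ⁴`. -/
abbrev E4 : Type := EuclideanSpace ℝ (Fin 4)

/-! ### Two-forms on `ℝ⁴` -/

/-- `Λ²`: the space of `2`-forms on `ℝ⁴`. -/
abbrev TwoForm : Type := E4 [⋀^Fin 2]→L[ℝ] ℝ

/-- The value `θ(u, v)`. -/
def ev (θ : TwoForm) (u v : E4) : ℝ := θ ![u, v]

lemma ev_self (θ : TwoForm) (v : E4) : ev θ v v = 0 :=
  θ.map_eq_zero_of_eq _ (i := 0) (j := 1) rfl (by decide)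

@[simp] lemma ev_add (α β : TwoForm) (u v : E4) : ev (α + β) u v = ev α u v + ev β u v := rfl
@[simp] lemma ev_smul (c : ℝ) (α : TwoForm) (u v : E4) : ev (c • α) u v = c * ev α u v := rfl
@[simp] lemma ev_neg (α : TwoForm) (u v : E4) : ev (-α) u v = -ev α u v := rfl
@[simp] lemma ev_sub (α β : TwoForm) (u v : E4) : ev (α - β) u v = ev α u v - ev β u v := rfl

lemma update_zero (u v x : E4) : Function.update ![u, v] 0 x = ![x, v] := by
  ext i : 1
  fin_cases i <;> rfl

lemma update_one (u v x : E4) : Function.update ![u, v] 1 x = ![u, x] := by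
  ext i : 1
  fin_cases i <;> rfl

lemma ev_add_left (θ : TwoForm) (u u' v : E4) : ev θ (u + u') v = ev θ u v + ev θ u' v := by
  have h := θ.map_update_add ![u, v] 0 u u'
  simpa only [ev, update_zero] using h

lemma ev_add_right (θ : TwoForm) (u v v' : E4) : ev θ u (v + v') = ev θ u v + ev θ u v' := by
  have h := θ.map_update_add ![u, v] 1 v v'
  simpa only [ev, update_one] using h

lemma ev_smul_left (θ : TwoForm) (c : ℝ) (u v : E4) : ev θ (c • u) v = c * ev θ u v := by
  have h := θ.map_update_smul ![u, v] 0 c u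
  simpa only [ev, update_zero, smul_eq_mul] using h

lemma ev_smul_right (θ : TwoForm) (c : ℝ) (u v : E4) : ev θ u (c • v) = c * ev θ u v := by
  have h := θ.map_update_smul ![u, v] 1 c v
  simpa only [ev, update_one, smul_eq_mul] using h

lemma ev_swap (θ : TwoForm) (u v : E4) : ev θ u v = -ev θ v u := by
  have h := ev_self θ (u + v)
  rw [ev_add_left, ev_add_right, ev_add_right, ev_self, ev_self] at h
  linarith

/-- The `2`-form given by an alternating bilinear map. -/
def mkForm (B : E4 →ₗ[ℝ] E4 →ₗ[ℝ] ℝ) (h : ∀ v, B v v = 0) : TwoForm where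
  toFun v := B (v 0) (v 1)
  map_update_add' := by
    intro _ m i x y
    fin_cases i <;> simp [Function.update]
  map_update_smul' := by
    intro _ m i c x
    fin_cases i <;> simp [Function.update]
  map_eq_zero_of_eq' := by
    intro v i j hij hne
    have h01 : v 0 = v 1 := by
      fin_cases i <;> fin_cases j <;> simp_all
    rw [h01]
    exact h _
  cont := by
    change Continuous fun v : Fin 2 → E4 ↦ B.toContinuousBilinearMap (v 0) (v 1)
    fun_prop

@[simp] lemma mkForm_ev (B : E4 →ₗ[ℝ] E4 →ₗ[ℝ] ℝ) (h : ∀ v, B v v = 0) (u v : E4) :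
    ev (mkForm B h) u v = B u v := rfl

lemma ext_ev {α β : TwoForm} (h : ∀ u v, ev α u v = ev β u v) : α = β := by
  ext m
  have hm : m = ![m 0, m 1] := by
    ext i : 1
    fin_cases i <;> rfl
  rw [hm]
  exact h _ _

/-- A `2`-form as a bilinear map. -/
def toBilin (θ : TwoForm) : E4 →ₗ[ℝ] E4 →ₗ[ℝ] ℝ :=
  LinearMap.mk₂ ℝ (ev θ) (ev_add_left θ) (ev_smul_left θ) (ev_add_right θ) (ev_smul_right θ)

@[simp] lemma toBilin_apply (θ : TwoForm) (u v : E4) : toBilin θ u v = ev θ u v := rfl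

/-- A `2`-form is determined by its six components in a basis. -/
lemma ext_basis (b : Basis (Fin 4) ℝ E4) {α β : TwoForm}
    (h01 : ev α (b 0) (b 1) = ev β (b 0) (b 1)) (h02 : ev α (b 0) (b 2) = ev β (b 0) (b 2))
    (h03 : ev α (b 0) (b 3) = ev β (b 0) (b 3)) (h12 : ev α (b 1) (b 2) = ev β (b 1) (b 2))
    (h13 : ev α (b 1) (b 3) = ev β (b 1) (b 3)) (h23 : ev α (b 2) (b 3) = ev β (b 2) (b 3)) :
    α = β := by
  have key : ∀ i j, ev α (b i) (b j) = ev β (b i) (b j) := by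
    intro i j
    fin_cases i <;> fin_cases j <;>
      first
      | exact (ev_self α _).trans (ev_self β _).symm
      | assumption
      | (rw [ev_swap α, ev_swap β]; exact congrArg Neg.neg (by assumption))
  have hB : toBilin α = toBilin β := LinearMap.ext_basis b b key
  exact ext_ev fun u v ↦ LinearMap.congr_fun₂ hB u v

instance : FiniteDimensional ℝ TwoForm :=
  Module.Finite.of_injective
    ({ toFun := fun θ i j ↦ ev θ ((EuclideanSpace.basisFun (Fin 4) ℝ).toBasis i)
          ((EuclideanSpace.basisFun (Fin 4) ℝ).toBasis j)
       map_add' := fun _ _ ↦ rfl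
       map_smul' := fun _ _ ↦ rfl } : TwoForm →ₗ[ℝ] Fin 4 → Fin 4 → ℝ)
    (by
      intro α β h
      have h' : ∀ i j, _ := fun i j ↦ congrFun (congrFun h i) j
      exact ext_basis (EuclideanSpace.basisFun (Fin 4) ℝ).toBasis (h' 0 1) (h' 0 2) (h' 0 3)
        (h' 1 2) (h' 1 3) (h' 2 3))

/-- The wedge product of two covectors: `(a ∧ b)(u, v) = a(u) b(v) - a(v) b(u)`. -/
def wedge (a b : E4 →ₗ[ℝ] ℝ) : TwoForm :=
  mkForm (a.smulRight b - b.smulRight a) (by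
    intro v
    simp [mul_comm])

lemma wedge_ev (a b : E4 →ₗ[ℝ] ℝ) (u v : E4) :
    ev (wedge a b) u v = a u * b v - a v * b u := by
  simp [wedge, mul_comm]

/-- The `4`-form `α ∧ β`, evaluated on four vectors. -/
def wedge22 (α β : TwoForm) (v : Fin 4 → E4) : ℝ :=
  ev α (v 0) (v 1) * ev β (v 2) (v 3) - ev α (v 0) (v 2) * ev β (v 1) (v 3)
    + ev α (v 0) (v 3) * ev β (v 1) (v 2) + ev α (v 2) (v 3) * ev β (v 0) (v 1)
    - ev α (v 1) (v 3) * ev β (v 0) (v 2) + ev α (v 1) (v 2) * ev β (v 0) (v 3)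

/-- A subspace of `Λ²` is definite for the wedge product if, for one fixed nonzero element of `Λ⁴`
(the volume form of a basis `c`), `θ ∧ θ` is a positive multiple of that element for all nonzero
`θ` in the subspace. Both signs are covered, since `c` may have either orientation. -/
def IsWedgeDefinite (S : Submodule ℝ TwoForm) : Prop :=
  ∃ c : Basis (Fin 4) ℝ E4, ∀ θ ∈ S, θ ≠ 0 → 0 < wedge22 θ θ c

/-- A maximal definite subspace of `Λ²`. -/
def IsMaximalDefinite (S : Submodule ℝ TwoForm) : Prop := Maximal IsWedgeDefinite S

/-- The action of an endomorphism `B` on `2`-forms, `(u, v) ↦ θ(B u, v) + θ(u, B v)`. -/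
def act : (E4 →L[ℝ] E4) →L[ℝ] TwoForm →L[ℝ] TwoForm :=
  LinearMap.toContinuousBilinearMap <| LinearMap.mk₂ ℝ
    (fun B θ ↦ mkForm ((toBilin θ).compl₁₂ B.toLinearMap LinearMap.id
        + (toBilin θ).compl₁₂ LinearMap.id B.toLinearMap) (by
      intro v
      simp [ev_swap θ v (B v)]))
    (by
      intro B C θ
      apply ext_ev
      intro u v
      simp [ev_add_right]
      ring)
    (by
      intro c B θ
      apply ext_ev
      intro u v
      simp
      ring)
    (by
      intro B θ θ'
      apply ext_ev
      intro u v
      simp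
      ring)
    (by
      intro c B θ
      apply ext_ev
      intro u v
      simp
      ring)

lemma act_ev (B : E4 →L[ℝ] E4) (θ : TwoForm) (u v : E4) :
    ev (act B θ) u v = ev θ (B u) v + ev θ u (B v) := rfl

/-! ### Self-duality

A basis `b` of `ℝ⁴` stands for the inner product and the orientation for which it is a positively
oriented orthonormal basis. -/

section Frame

variable (b : Basis (Fin 4) ℝ E4)

/-- The covectors dual to `b`. -/
def coframe (i : Fin 4) : E4 →ₗ[ℝ] ℝ := b.coord i

lemma coframe_apply (i j : Fin 4) : coframe b i (b j) = if j = i then 1 else 0 := by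
  simp [coframe, Finsupp.single_apply]

/-- The `2`-form `bⁱ ∧ bʲ`. -/
def cov2 (i j : Fin 4) : TwoForm := wedge (coframe b i) (coframe b j)

lemma cov2_ev (i j k l : Fin 4) : ev (cov2 b i j) (b k) (b l)
    = (if k = i then 1 else 0) * (if l = j then 1 else 0)
      - (if l = i then 1 else 0) * (if k = j then 1 else 0) := by
  simp only [cov2, wedge_ev, coframe_apply]

/-- The inner product on `Λ²` for which the `bⁱ ∧ bʲ`, `i < j`, are orthonormal. -/
def formInner : LinearMap.BilinForm ℝ TwoForm :=
  LinearMap.mk₂ ℝ (fun α β ↦ (1 / 2) * ∑ i, ∑ j, ev α (b i) (b j) * ev β (b i) (b j))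
    (by
      intro α α' β
      simp only [ev_add, add_mul, Finset.sum_add_distrib, mul_add])
    (by
      intro c α β
      simp only [ev_smul, mul_assoc, ← Finset.mul_sum, smul_eq_mul]
      ring)
    (by
      intro α β β'
      simp only [ev_add, mul_add, Finset.sum_add_distrib])
    (by
      intro c α β
      simp only [ev_smul, mul_left_comm _ c, ← Finset.mul_sum, smul_eq_mul])

lemma formInner_apply (α β : TwoForm) :
    formInner b α β = (1 / 2) * ∑ i, ∑ j, ev α (b i) (b j) * ev β (b i) (b j) := rfl

/-- The Hodge star on `Λ²`: `⋆(bⁱ ∧ bʲ) = bᵏ ∧ bˡ` for even permutations `(i, j, k, l)`. -/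
def hodge : TwoForm →ₗ[ℝ] TwoForm where
  toFun θ := ev θ (b 2) (b 3) • cov2 b 0 1 + ev θ (b 3) (b 1) • cov2 b 0 2
    + ev θ (b 1) (b 2) • cov2 b 0 3 + ev θ (b 0) (b 1) • cov2 b 2 3
    + ev θ (b 0) (b 2) • cov2 b 3 1 + ev θ (b 0) (b 3) • cov2 b 1 2
  map_add' α β := by
    simp only [ev_add]
    module
  map_smul' c α := by
    simp only [ev_smul, RingHom.id_apply]
    module

lemma hodge_hodge (θ : TwoForm) : hodge b (hodge b θ) = θ := by
  have h := ev_swap θ (b 3) (b 1)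
  apply ext_basis b <;> simp [hodge, cov2_ev, h]

/-- `Λ⁺`, the self-dual forms. -/
def selfDual : Submodule ℝ TwoForm := Module.End.eigenspace (hodge b) 1

/-- `Λ⁻`, the anti-self-dual forms. -/
def antiSelfDual : Submodule ℝ TwoForm := Module.End.eigenspace (hodge b) (-1)

lemma mem_selfDual {θ : TwoForm} : θ ∈ selfDual b ↔ hodge b θ = θ := by
  simp [selfDual]

lemma mem_antiSelfDual {θ : TwoForm} : θ ∈ antiSelfDual b ↔ hodge b θ = -θ := by
  simp [antiSelfDual]

/-- The projection `(1 + ⋆) / 2` of `Λ²` onto `Λ⁺`. -/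
def projPlus : TwoForm →ₗ[ℝ] selfDual b :=
  LinearMap.codRestrict (selfDual b) ((1 / 2 : ℝ) • (LinearMap.id + hodge b)) (by
    intro θ
    rw [mem_selfDual]
    simp [hodge_hodge, add_comm])

/-- The projection `(1 - ⋆) / 2` of `Λ²` onto `Λ⁻`. -/
def projMinus : TwoForm →ₗ[ℝ] antiSelfDual b :=
  LinearMap.codRestrict (antiSelfDual b) ((1 / 2 : ℝ) • (LinearMap.id - hodge b)) (by
    intro θ
    rw [mem_antiSelfDual]
    simp only [LinearMap.smul_apply, LinearMap.sub_apply, LinearMap.id_apply, map_smul, map_sub,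
      hodge_hodge]
    module)

/-- The Lie bracket of `2`-forms under the identification `Λ² ≅ 𝔰𝔬(4)` in which `θ` corresponds
to the endomorphism `A` with `⟨u, A v⟩ = θ(u, v)`, so that `x ∧ y` is `v ↦ ⟨y, v⟩ x - ⟨x, v⟩ y`.
The bracket is the form of the commutator `[A, A']`. -/
def bracket (α β : TwoForm) : TwoForm :=
  mkForm (∑ i, (((toBilin α).flip (b i)).smulRight (toBilin β (b i))
      - ((toBilin β).flip (b i)).smulRight (toBilin α (b i)))) (by
    intro v
    simp only [LinearMap.sum_apply, LinearMap.sub_apply, LinearMap.smulRight_apply,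
      LinearMap.flip_apply, LinearMap.smul_apply, smul_eq_mul, toBilin_apply]
    apply Finset.sum_eq_zero
    intro i _
    rw [ev_swap α v (b i), ev_swap β v (b i)]
    ring)

lemma bracket_ev (α β : TwoForm) (u v : E4) :
    ev (bracket b α β) u v
      = ∑ i, (ev α u (b i) * ev β (b i) v - ev β u (b i) * ev α (b i) v) := by
  simp [bracket]

/-- `⟨[α, β], γ⟩`. On each of the `𝔰𝔬(3)` summands `Λ⁺` and `Λ⁻` of `Λ² ≅ 𝔰𝔬(4)` this is a volume
form of the natural orientation of `𝔰𝔬(3)`, the one in which `ξ, η, [ξ, η]` is positive for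
linearly independent `ξ, η`. -/
def lieVolume (α β γ : TwoForm) : ℝ := formInner b (bracket b α β) γ

/-- A basis of `Λ⁺` of orthogonal forms of square length `2`. It is positive in the natural
orientation, since `[f₀, f₁] = 2 f₂`. -/
def plusForm : Fin 3 → TwoForm :=
  ![-(cov2 b 0 1 + cov2 b 2 3), -(cov2 b 0 2 + cov2 b 3 1), -(cov2 b 0 3 + cov2 b 1 2)]

/-- A basis of `Λ⁻` of orthogonal forms of square length `2`. It is positive in the natural
orientation, since `[f₀, f₁] = 2 f₂`. -/
def minusForm : Fin 3 → TwoForm :=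
  ![cov2 b 0 1 - cov2 b 2 3, cov2 b 0 2 - cov2 b 3 1, cov2 b 0 3 - cov2 b 1 2]

lemma bracket_plusForm :
    bracket b (plusForm b 0) (plusForm b 1) = (2 : ℝ) • plusForm b 2 := by
  apply ext_basis b <;>
    simp [bracket_ev, plusForm, Fin.sum_univ_four, cov2_ev] <;> norm_num

lemma bracket_minusForm :
    bracket b (minusForm b 0) (minusForm b 1) = (2 : ℝ) • minusForm b 2 := by
  apply ext_basis b <;>
    simp [bracket_ev, minusForm, Fin.sum_univ_four, cov2_ev] <;> norm_num

lemma plusForm_mem (i : Fin 3) : plusForm b i ∈ selfDual b := by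
  rw [mem_selfDual]
  fin_cases i <;> apply ext_basis b <;> simp [hodge, plusForm, cov2_ev]

lemma minusForm_mem (i : Fin 3) : minusForm b i ∈ antiSelfDual b := by
  rw [mem_antiSelfDual]
  fin_cases i <;> apply ext_basis b <;> simp [hodge, minusForm, cov2_ev]

lemma selfDual_ev {θ : TwoForm} (h : θ ∈ selfDual b) :
    ev θ (b 2) (b 3) = ev θ (b 0) (b 1) ∧ ev θ (b 1) (b 3) = -ev θ (b 0) (b 2) ∧
      ev θ (b 1) (b 2) = ev θ (b 0) (b 3) := by
  rw [mem_selfDual] at h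
  refine ⟨?_, ?_, ?_⟩ <;> conv_lhs => rw [← h]
  all_goals simp [hodge, cov2_ev]

lemma antiSelfDual_ev {θ : TwoForm} (h : θ ∈ antiSelfDual b) :
    ev θ (b 2) (b 3) = -ev θ (b 0) (b 1) ∧ ev θ (b 1) (b 3) = ev θ (b 0) (b 2) ∧
      ev θ (b 1) (b 2) = -ev θ (b 0) (b 3) := by
  rw [mem_antiSelfDual] at h
  have h' : θ = -hodge b θ := by rw [h, neg_neg]
  refine ⟨?_, ?_, ?_⟩ <;> conv_lhs => rw [h']
  all_goals simp [hodge, cov2_ev]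

/-- The basis `plusForm` of `Λ⁺`. -/
def plusBasis : Basis (Fin 3) ℝ (selfDual b) :=
  Basis.ofEquivFun
    { toFun := fun θ ↦ ![-ev θ.1 (b 0) (b 1), -ev θ.1 (b 0) (b 2), -ev θ.1 (b 0) (b 3)]
      map_add' := by
        intro α β
        ext i
        fin_cases i <;> simp <;> ring
      map_smul' := by
        intro c α
        ext i
        fin_cases i <;> simp
      invFun := fun c ↦ ∑ i, c i • ⟨plusForm b i, plusForm_mem b i⟩
      left_inv := by
        rintro ⟨θ, hθ⟩
        obtain ⟨h1, h2, h3⟩ := selfDual_ev b hθ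
        apply Subtype.ext
        apply ext_basis b <;> simp [Fin.sum_univ_three, plusForm, cov2_ev, h1, h2, h3]
      right_inv := by
        intro c
        ext i
        fin_cases i <;> simp [Fin.sum_univ_three, plusForm, cov2_ev] }

/-- The basis `minusForm` of `Λ⁻`. -/
def minusBasis : Basis (Fin 3) ℝ (antiSelfDual b) :=
  Basis.ofEquivFun
    { toFun := fun θ ↦ ![ev θ.1 (b 0) (b 1), ev θ.1 (b 0) (b 2), ev θ.1 (b 0) (b 3)]
      map_add' := by
        intro α β
        ext i
        fin_cases i <;> simp
      map_smul' := by
        intro c α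
        ext i
        fin_cases i <;> simp
      invFun := fun c ↦ ∑ i, c i • ⟨minusForm b i, minusForm_mem b i⟩
      left_inv := by
        rintro ⟨θ, hθ⟩
        obtain ⟨h1, h2, h3⟩ := antiSelfDual_ev b hθ
        apply Subtype.ext
        apply ext_basis b <;> simp [Fin.sum_univ_three, minusForm, cov2_ev, h1, h2, h3]
      right_inv := by
        intro c
        ext i
        fin_cases i <;> simp [Fin.sum_univ_three, minusForm, cov2_ev] }

lemma plusBasis_apply (i : Fin 3) : (plusBasis b i : TwoForm) = plusForm b i := by
  simp [plusBasis, Pi.single_apply]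

lemma minusBasis_apply (i : Fin 3) : (minusBasis b i : TwoForm) = minusForm b i := by
  simp [minusBasis, Pi.single_apply]

end Frame

/-! ### Curvature in a chart -/

/-- The curvature at `p` of the connection `∇_u s = D_u s + A(u) s` on the trivial bundle with
fibre `W`, i.e. `F(u, v) = [∇_u, ∇_v] = D_u A(v) - D_v A(u) + [A(u), A(v)]` for constant fields
`u, v`. -/
def curvature {W : Type*} [NormedAddCommGroup W] [NormedSpace ℝ W]
    (A : E4 → E4 →L[ℝ] W →L[ℝ] W) (p u v : E4) : W →L[ℝ] W :=
  fderiv ℝ A p u v - fderiv ℝ A p v u + (A p u ∘L A p v - A p v ∘L A p u)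

/-- The Koszul formula for constant fields: the form
`(u, v) ↦ (z ↦ (D_u g(v, z) + D_v g(u, z) - D_z g(u, v)) / 2)`. -/
def koszul (g : E4 → E4 →L[ℝ] E4 →L[ℝ] ℝ) (q : E4) : E4 →L[ℝ] E4 →L[ℝ] E4 →L[ℝ] ℝ :=
  (1 / 2 : ℝ) • (fderiv ℝ g q + (fderiv ℝ g q).flip
    - (ContinuousLinearMap.flipₗᵢ ℝ E4 E4 ℝ).toContinuousLinearEquiv.toContinuousLinearMap ∘L
        (fderiv ℝ g q).flip)

lemma koszul_apply (g : E4 → E4 →L[ℝ] E4 →L[ℝ] ℝ) (q u v z : E4) :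
    koszul g q u v z
      = (1 / 2) * (fderiv ℝ g q u v z + fderiv ℝ g q v u z - fderiv ℝ g q z u v) := by
  simp [koszul]

/-- The Levi-Civita connection `∇_u v = D_u v + Γ(u, v)` of the metric `g`: `Γ(u, v)` is the vector
that `g` sends to the Koszul form. -/
def leviCivita (g : E4 → E4 →L[ℝ] E4 →L[ℝ] ℝ) (q : E4) : E4 →L[ℝ] E4 →L[ℝ] E4 :=
  ContinuousLinearMap.compL ℝ E4 (E4 →L[ℝ] ℝ) E4 (g q).inverse ∘L koszul g q

/-- The connection induced on `2`-forms by a connection `∇_u v = D_u v + Γ(u, v)` on vector fields: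
`(∇_u θ)(v, w) = (D_u θ)(v, w) - θ(Γ(u, v), w) - θ(v, Γ(u, w))`. -/
def formConnection (Γ : E4 → E4 →L[ℝ] E4 →L[ℝ] E4) (q : E4) : E4 →L[ℝ] TwoForm →L[ℝ] TwoForm :=
  -(act ∘L Γ q)

lemma formConnection_apply (Γ : E4 → E4 →L[ℝ] E4 →L[ℝ] E4) (q u : E4) (θ : TwoForm) :
    formConnection Γ q u θ = -act (Γ q u) θ := rfl

/-! ### Definite connections -/

/-- `Λ² ⊗ End W`: the `2`-forms with values in the endomorphisms of `W`. -/
abbrev EndForm (W : Type*) [AddCommGroup W] [Module ℝ W] : Type _ :=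
  {Φ : E4 →ₗ[ℝ] E4 →ₗ[ℝ] Module.End ℝ W // ∀ u, Φ u u = 0}

section Definite

variable {W : Type*} [AddCommGroup W] [Module ℝ W] (B : LinearMap.BilinForm ℝ W) (Φ : EndForm W)

/-- The curvature map `𝔰𝔬(W) ≅ 𝔰𝔬(W)* → Λ²` of the curvature `Φ`, where `B` is the inner product of
`W` and `𝔰𝔬(W)` is identified with its dual by its invariant inner product `-tr(ξ η) / 2`. -/
def curvatureMap : skewAdjointLieSubalgebra B →ₗ[ℝ] TwoForm where
  toFun ξ := mkForm
    (Φ.1.compr₂ ((-(1 / 2) : ℝ) • (LinearMap.trace ℝ W ∘ₗ LinearMap.mulLeft ℝ ξ.1))) (by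
      intro v
      simp [Φ.2 v])
  map_add' ξ η := by
    apply ext_ev
    intro u v
    simp [add_mul]
    ring
  map_smul' c ξ := by
    apply ext_ev
    intro u v
    simp
    ring

lemma curvatureMap_ev (ξ : skewAdjointLieSubalgebra B) (u v : E4) :
    ev (curvatureMap B Φ ξ) u v = -(1 / 2) * LinearMap.trace ℝ W (ξ.1 * Φ.1 u v) := by
  simp [curvatureMap]

/-- The curvature is definite if the image of the curvature map is a maximal definite subspace. -/
def IsDefiniteAt : Prop := IsMaximalDefinite (LinearMap.range (curvatureMap B Φ))

/-- The Pontrjagin form `-tr(Φ ∧ Φ)`, evaluated on four vectors. -/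
def pontrjagin (v : Fin 4 → E4) : ℝ :=
  -2 * LinearMap.trace ℝ W (Φ.1 (v 0) (v 1) * Φ.1 (v 2) (v 3) - Φ.1 (v 0) (v 2) * Φ.1 (v 1) (v 3)
    + Φ.1 (v 0) (v 3) * Φ.1 (v 1) (v 2))

/-- The orientation `o` is the one for which the Pontrjagin form is positive. -/
def InducesOrientation (o : Orientation ℝ E4 (Fin 4)) : Prop :=
  ∀ c : Basis (Fin 4) ℝ E4, c.orientation = o → 0 < pontrjagin Φ c

/-- The metric with oriented orthonormal basis `c` lies in the conformal class induced by the
curvature: the image of the curvature map is its space of self-dual forms for the induced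
orientation. (Scaling the metric affects none of the notions below.) -/
def InducesMetric (c : Basis (Fin 4) ℝ E4) : Prop :=
  InducesOrientation Φ c.orientation ∧ LinearMap.range (curvatureMap B Φ) = selfDual c

variable {B} in
/-- A volume form of the natural orientation of `𝔰𝔬(W)`, in which `ξ, η, [ξ, η]` is positive for
linearly independent `ξ, η`. -/
def soVolume (ξ η ζ : skewAdjointLieSubalgebra B) : ℝ :=
  -LinearMap.trace ℝ W ((⁅ξ, η⁆ : skewAdjointLieSubalgebra B).1 * ζ.1)

/-- The curvature is positive: for the induced metric, the curvature map preserves the natural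
orientations of `𝔰𝔬(W)` and of the self-dual forms. -/
def IsPositiveAt : Prop :=
  ∃ c, InducesMetric B Φ c ∧ ∀ ξ η ζ, 0 < soVolume ξ η ζ →
    0 < lieVolume c (curvatureMap B Φ ξ) (curvatureMap B Φ η) (curvatureMap B Φ ζ)

/-- The curvature is negative: for the induced metric, the curvature map reverses the natural
orientations of `𝔰𝔬(W)` and of the self-dual forms. -/
def IsNegativeAt : Prop :=
  ∃ c, InducesMetric B Φ c ∧ ∀ ξ η ζ, 0 < soVolume ξ η ζ →
    lieVolume c (curvatureMap B Φ ξ) (curvatureMap B Φ η) (curvatureMap B Φ ζ) < 0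

end Definite

/-! ### Decomposition of the curvature

`b` is an oriented orthonormal basis and `R u v w` is the curvature tensor `R(u, v) w`. -/

section Decomposition

variable (b : Basis (Fin 4) ℝ E4) (R : E4 → E4 → E4 →L[ℝ] E4)

/-- The Ricci curvature, `Ric(v, w) = tr (u ↦ R(u, v) w)`. -/
def ricci (v w : E4) : ℝ := ∑ i, b.coord i (R (b i) v w)

/-- The scalar curvature. -/
def scal : ℝ := ∑ i, ricci b R (b i) (b i)

/-- The trace-free Ricci curvature as an endomorphism of the tangent space. -/
def ricciZero : E4 →L[ℝ] E4 :=
  ∑ i, ∑ j, (ricci b R (b i) (b j) - if i = j then scal b R / 4 else 0) •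
    (b.coord i).toContinuousLinearMap.smulRight (b j)

/-- The operator on `Λ²` given by the trace-free Ricci curvature:
`x ∧ y ↦ (ric₀ x ∧ y + x ∧ ric₀ y) / 2`. -/
def ricOp : TwoForm →ₗ[ℝ] TwoForm := (1 / 2 : ℝ) • (act (ricciZero b R)).toLinearMap

/-- The curvature operator `Rm` on `Λ²`, with
`⟨Rm(bⁱ ∧ bʲ), bᵏ ∧ bˡ⟩ = ⟨bₖ, R(bᵢ, bⱼ) bₗ⟩`; it is the identity for the unit sphere. -/
def riemOp : TwoForm →ₗ[ℝ] TwoForm where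
  toFun θ := ∑ i, ∑ j, ∑ k, ∑ l,
    ((1 / 4) * ev θ (b i) (b j) * b.coord k (R (b i) (b j) (b l))) • cov2 b k l
  map_add' α β := by
    simp only [ev_add, mul_add, add_mul, add_smul, Finset.sum_add_distrib]
  map_smul' c α := by
    simp only [ev_smul, Finset.smul_sum, smul_smul, RingHom.id_apply]
    refine Finset.sum_congr rfl fun i _ ↦ Finset.sum_congr rfl fun j _ ↦
      Finset.sum_congr rfl fun k _ ↦ Finset.sum_congr rfl fun l _ ↦ ?_
    congr 1
    ring

/-- The Weyl curvature operator on `Λ²`, obtained from `Rm` by removing the trace-free Ricci and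
the scalar parts. -/
def weylOp : TwoForm →ₗ[ℝ] TwoForm :=
  riemOp b R - ricOp b R - (scal b R / 12) • LinearMap.id

/-- `W⁺ : Λ⁺ → Λ⁺`. -/
def weylPlus : Module.End ℝ (selfDual b) := projPlus b ∘ₗ weylOp b R ∘ₗ (selfDual b).subtype

/-- `W⁺ + s/12`. -/
def weylScal : Module.End ℝ (selfDual b) := weylPlus b R + (scal b R / 12) • 1

/-- `Ric₀ : Λ⁺ → Λ⁻`. -/
def ricPlus : selfDual b →ₗ[ℝ] antiSelfDual b := projMinus b ∘ₗ ricOp b R ∘ₗ (selfDual b).subtype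

/-- The matrix of `Ric₀ : Λ⁺ → Λ⁻` in positive orthogonal bases of vectors of equal lengths. -/
def ricMatrix : Matrix (Fin 3) (Fin 3) ℝ := LinearMap.toMatrix (plusBasis b) (minusBasis b) (ricPlus b R)

/-- The determinant of `Ric₀ : Λ⁺ → Λ⁻`, a map between oriented inner product spaces. -/
def detRic : ℝ := (ricMatrix b R).det

/-- The adjoint `Ric₀* : Λ⁻ → Λ⁺`. -/
def ricAdjoint : antiSelfDual b →ₗ[ℝ] selfDual b :=
  Matrix.toLin (minusBasis b) (plusBasis b) (ricMatrix b R).transpose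

/-- `𝒟 = (W⁺ + s/12)² - Ric₀* Ric₀`. -/
def opD : Module.End ℝ (selfDual b) :=
  weylScal b R ^ 2 - (ricAdjoint b R ∘ₗ ricPlus b R : Module.End ℝ (selfDual b))

/-- Positive definiteness of an endomorphism of `Λ⁺`. -/
def IsPosDef {b : Basis (Fin 4) ℝ E4} (T : Module.End ℝ (selfDual b)) : Prop :=
  ∀ α : selfDual b, α ≠ 0 → 0 < formInner b (T α) α

/-- Negative definiteness of an endomorphism of `Λ⁺`. -/
def IsNegDef {b : Basis (Fin 4) ℝ E4} (T : Module.End ℝ (selfDual b)) : Prop :=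
  ∀ α : selfDual b, α ≠ 0 → formInner b (T α) α < 0

end Decomposition

/-! ### Oriented Riemannian four-manifolds -/

/-- An orientation of a smooth `4`-manifold: a choice of orientation of each tangent space such
that positively oriented smooth frames exist near every point. -/
structure ManifoldOrientation (M : Type*) [TopologicalSpace M] [ChartedSpace E4 M]
    [IsManifold (𝓡 4) ((⊤ : ℕ∞) : WithTop ℕ∞) M] where
  /-- The orientation of the tangent space at `x`. -/
  orient (x : M) : Orientation ℝ (TangentSpace (𝓡 4) x) (Fin 4)
  exists_frame (x₀ : M) : ∃ X : Fin 4 → (x : M) → TangentSpace (𝓡 4) x,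
    (∀ i, ContMDiffAt (𝓡 4) ((𝓡 4).prod 𝓘(ℝ, E4)) ((⊤ : ℕ∞) : WithTop ℕ∞)
      (fun x ↦ (⟨x, X i x⟩ : TotalSpace E4 (TangentSpace (𝓡 4) : M → Type))) x₀) ∧
    ∀ᶠ x in 𝓝 x₀, ∃ c : Basis (Fin 4) ℝ (TangentSpace (𝓡 4) x),
      (∀ i, c i = X i x) ∧ c.orientation = orient x

section Manifold

variable {M : Type*} [TopologicalSpace M] [ChartedSpace E4 M]
  [IsManifold (𝓡 4) ((⊤ : ℕ∞) : WithTop ℕ∞) M]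

/-- The derivative at `x` of the chart around `x`. -/
def chartDeriv (x : M) : TangentSpace (𝓡 4) x ≃ₗ[ℝ] E4 :=
  ((mdifferentiable_chart (I := 𝓡 4) x).mfderiv (mem_chart_source E4 x)).toLinearEquiv

variable [RiemannianBundle (fun x : M ↦ TangentSpace (𝓡 4) x)]

/-- The Riemannian metric in the chart `φ` around `x`:
`g_q(u, v) = ⟨dφ⁻¹_q u, dφ⁻¹_q v⟩`. -/
def chartMetric (x : M) (q : E4) : E4 →L[ℝ] E4 →L[ℝ] ℝ :=
  LinearMap.toContinuousBilinearMap <|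
    (innerₗ (TangentSpace (𝓡 4) ((chartAt E4 x).symm q))).compl₁₂
      (mfderiv (𝓡 4) (𝓡 4) (chartAt E4 x).symm q).toLinearMap
      (mfderiv (𝓡 4) (𝓡 4) (chartAt E4 x).symm q).toLinearMap

/-- An oriented orthonormal basis of the tangent space at `x`, in the chart around `x`. -/
def frame (o : ManifoldOrientation M) (x : M) : Basis (Fin 4) ℝ E4 :=
  (Orientation.finOrthonormalBasis (E := TangentSpace (𝓡 4) x) (n := 4) (by norm_num)
    (finrank_euclideanSpace_fin (𝕜 := ℝ) (n := 4)) (o.orient x)).toBasis.map (chartDeriv x)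

/-- The curvature tensor at `x`, in the chart around `x`. -/
def riemann (x : M) : E4 → E4 → E4 →L[ℝ] E4 :=
  curvature (leviCivita (chartMetric x)) (chartAt E4 x x)

variable (o : ManifoldOrientation M) (x : M)

/-- The fibre of `Λ⁺` at `x`, in the chart around `x`. -/
abbrev LambdaPlus : Submodule ℝ TwoForm := selfDual (frame o x)

/-- The inner product of `Λ⁺` at `x`. -/
def plusInner : LinearMap.BilinForm ℝ (LambdaPlus o x) :=
  (formInner (frame o x)).restrict (LambdaPlus o x)

/-- The curvature at `x` of the connection on `Λ⁺` induced by the Levi-Civita connection. The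
connection on `Λ²` preserves the subbundle `Λ⁺`, hence so does its curvature; the projection to
`Λ⁺` is there for typing only. -/
def plusCurvature : EndForm (LambdaPlus o x) :=
  ⟨LinearMap.mk₂ ℝ (fun u v ↦ projPlus (frame o x) ∘ₗ
      (curvature (formConnection (leviCivita (chartMetric x))) (chartAt E4 x x) u v).toLinearMap ∘ₗ
      (LambdaPlus o x).subtype)
    (by
      intro u u' v
      ext1 α
      simp [curvature]
      module)
    (by
      intro c u v
      ext1 α
      simp [curvature]
      module)
    (by
      intro u v v'
      ext1 α
      simp [curvature]
      module)
    (by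
      intro c u v
      ext1 α
      simp [curvature]
      module), by
    intro u
    ext1 α
    simp [curvature]⟩

/-- The curvature at `x` of the connection on `Λ⁺` is definite. -/
def LambdaPlusDefiniteAt : Prop := IsDefiniteAt (plusInner o x) (plusCurvature o x)

/-- The Levi-Civita connection on `Λ⁺` is a definite connection. -/
def LambdaPlusDefinite : Prop := ∀ x, LambdaPlusDefiniteAt o x

/-- The connection on `Λ⁺` induces the orientation `o'` of `M` at `x`. -/
def LambdaPlusInduces (o' : Orientation ℝ (TangentSpace (𝓡 4) x) (Fin 4)) : Prop :=
  InducesOrientation (plusCurvature o x) (Orientation.map (Fin 4) (chartDeriv x) o')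

/-- The sign of the connection on `Λ⁺` at `x` is positive. -/
def LambdaPlusPositiveAt : Prop := IsPositiveAt (plusInner o x) (plusCurvature o x)

/-- The sign of the connection on `Λ⁺` at `x` is negative. -/
def LambdaPlusNegativeAt : Prop := IsNegativeAt (plusInner o x) (plusCurvature o x)

/-- `W⁺ + s/12` at `x`. -/
def weylScalAt : Module.End ℝ (LambdaPlus o x) := weylScal (frame o x) (riemann x)

/-- The determinant of `Ric₀ : Λ⁺ → Λ⁻` at `x`. -/
def detRicAt : ℝ := detRic (frame o x) (riemann x)

/-- `𝒟` at `x`. -/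
def opDAt : Module.End ℝ (LambdaPlus o x) := opD (frame o x) (riemann x)

end Manifold

end

end DefConn

namespace DefConn

noncomputable section

/-! ### The Levi-Civita connection of a metric on a domain of `ℝ⁴` -/

section Chart

variable {g : E4 → E4 →L[ℝ] E4 →L[ℝ] ℝ} {p : E4}

/-! Write `A` and `B` for the matrices of W⁺ + s/12 and Ric₀ in the bases `plusBasis` and
`minusBasis`. The endomorphism R(u, v) acts on Λ⁺ as the cross product with its self-dual part. By
the pair symmetry of R, the curvature map of Λ⁺ is therefore the restriction of Rm to Λ⁺, that is x
↦ (A x, B x) in Λ⁺ ⊕ Λ⁻ (`plusCurvature_eq_soEnd`, `curvatureMap_soElt`).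

The wedge square of (A x, B x) is 2(|A x|² - |B x|²) times the volume form. Since `A` is symmetric,
the coefficient is ⟨𝒟 x, x⟩ (`wedge22_linearCombination`, `formInner_opD`). The wedge form has
signature (3, 3), so a subspace is maximal definite exactly when it is definite of dimension 3
(`isMaximalDefinite_iff`). Hence the connection is definite at a point exactly when 𝒟 is. The
Pontrjagin form is a positive multiple of the trace of this quadratic form, so the sign of 𝒟 decides
the induced orientation.

For the sign of the connection, the image of the curvature map is Λ⁺ of some metric
(`exists_selfDual_eq`). The natural orientation of that space can be tested by contracting its forms
with the fixed vector `b 0` (`exists_lieVolume_eq`). Contraction turns (A x, B x) into B x - A x, so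
the sign is that of det(A - B), corrected by the induced orientation (`lieVolume_curvatureMap`). If
𝒟 > 0, then |B x| < |A x| for all x ≠ 0, so A - sB stays invertible for 0 ≤ s ≤ 1 and det(A - B) has
the sign of det A. If 𝒟 < 0, the roles of `A` and `B` are exchanged (`det_mul_det_sub_pos`). -/

lemma leviCivita_metric {q : E4} (hq : (g q).IsInvertible) (u v z : E4) :
    g q (leviCivita g q u v) z = koszul g q u v z := by
  have h : g q ((g q).inverse (koszul g q u v)) = koszul g q u v := by
    have := hq.self_comp_inverse
    exact congrArg (fun T ↦ T (koszul g q u v)) this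
  exact congrArg (fun T ↦ T z) h

lemma fderiv_metric_symm (hs : ∀ᶠ q in 𝓝 p, ∀ u v, g q u v = g q v u)
    (hd : ∀ᶠ q in 𝓝 p, DifferentiableAt ℝ g q) :
    ∀ᶠ q in 𝓝 p, ∀ z u v, fderiv ℝ g q z u v = fderiv ℝ g q z v u := by
  filter_upwards [hs.eventually_nhds, hd] with q hq hdq z u v
  -- Differentiating the symmetry at `q` needs it on a neighbourhood of `q`, hence `eventually_nhds`
  -- above.
  have h1 : fderiv ℝ (fun q ↦ g q u v) q = fderiv ℝ (fun q ↦ g q v u) q :=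
    Filter.EventuallyEq.fderiv_eq (by filter_upwards [hq] with y hy using hy u v)
  have h2 : ∀ u v, fderiv ℝ (fun q ↦ g q u v) q z = fderiv ℝ g q z u v := by
    intro u v
    have := ((hdq.hasFDerivAt.clm_apply (hasFDerivAt_const u q)).clm_apply (hasFDerivAt_const v q))
    rw [this.fderiv]
    simp
  rw [← h2, ← h2, h1]

lemma leviCivita_symm (hs : ∀ᶠ q in 𝓝 p, ∀ u v, g q u v = g q v u)
    (hd : ∀ᶠ q in 𝓝 p, DifferentiableAt ℝ g q) :
    ∀ᶠ q in 𝓝 p, ∀ u v, leviCivita g q u v = leviCivita g q v u := by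
  filter_upwards [fderiv_metric_symm hs hd] with q hq u v
  have : koszul g q u v = koszul g q v u := by
    ext z
    rw [koszul_apply, koszul_apply, hq z u v]
    ring
  change (g q).inverse (koszul g q u v) = (g q).inverse (koszul g q v u)
  rw [this]

lemma leviCivita_compat (hs : ∀ᶠ q in 𝓝 p, ∀ u v, g q u v = g q v u)
    (hi : ∀ᶠ q in 𝓝 p, (g q).IsInvertible)
    (hd : ∀ᶠ q in 𝓝 p, DifferentiableAt ℝ g q) :
    ∀ᶠ q in 𝓝 p, ∀ u v z, g q (leviCivita g q u v) z + g q v (leviCivita g q u z)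
      = fderiv ℝ g q u v z := by
  filter_upwards [fderiv_metric_symm hs hd, hs, hi] with q hq hsq hiq u v z
  rw [hsq v, leviCivita_metric hiq, leviCivita_metric hiq, koszul_apply, koszul_apply,
    hq z u v, hq v u z, hq u z v]
  ring

lemma differentiableAt_leviCivita (hg : ContDiffAt ℝ 2 g p) (hi : (g p).IsInvertible) :
    DifferentiableAt ℝ (leviCivita g) p := by
  have h1 : DifferentiableAt ℝ (fderiv ℝ g) p :=
    (hg.fderiv_right (m := 1) le_rfl).differentiableAt one_ne_zero
  have h2 : DifferentiableAt ℝ (fun q ↦ (g q).inverse) p :=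
    ((hi.contDiffAt_map_inverse (n := 1)).differentiableAt one_ne_zero).comp p
      (hg.differentiableAt two_ne_zero)
  have h3 : DifferentiableAt ℝ (koszul g) p := by
    have hf : DifferentiableAt ℝ (fun q ↦ (fderiv ℝ g q).flip) p :=
      (ContinuousLinearMap.flipₗᵢ ℝ E4 E4 (E4 →L[ℝ] ℝ)).differentiableAt.comp p h1
    have := ((h1.add hf).sub ((differentiableAt_const
      (ContinuousLinearMap.flipₗᵢ ℝ E4 E4
        ℝ).toContinuousLinearEquiv.toContinuousLinearMap).clm_comp hf)).const_smul (1 / 2 : ℝ)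
    exact this
  exact ((ContinuousLinearMap.compL ℝ E4 (E4 →L[ℝ] ℝ) E4).differentiableAt.comp p h2).clm_comp h3

/-- A curvature tensor for the inner product `h`: the algebraic symmetries of `R(u, v) w`. -/
structure IsCurvatureTensor (h : E4 → E4 → ℝ) (R : E4 → E4 → E4 →L[ℝ] E4) : Prop where
  add_left : ∀ u u' v, R (u + u') v = R u v + R u' v
  smul_left : ∀ (c : ℝ) u v, R (c • u) v = c • R u v
  alt : ∀ u v, R u v = -R v u
  bianchi : ∀ u v w, R u v w + R v w u + R w u v = 0
  skew : ∀ u v w z, h (R u v w) z + h w (R u v z) = 0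

lemma fderiv_apply_apply {F : Type*} [NormedAddCommGroup F] [NormedSpace ℝ F]
    {Γ : E4 → E4 →L[ℝ] E4 →L[ℝ] F} (hΓ : DifferentiableAt ℝ Γ p) (u v w : E4) :
    fderiv ℝ (fun q ↦ Γ q v w) p u = fderiv ℝ Γ p u v w := by
  have := ((hΓ.hasFDerivAt.clm_apply (hasFDerivAt_const v p)).clm_apply (hasFDerivAt_const w p))
  rw [this.fderiv]
  simp

/-- The Bianchi identity comes from the symmetry of Γ and of its derivative. Skewness comes from
differentiating metric compatibility once more and using the symmetry of the second derivative of
`g`. -/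
theorem isCurvatureTensor_leviCivita (hg : ContDiffAt ℝ 2 g p)
    (hs : ∀ᶠ q in 𝓝 p, ∀ u v, g q u v = g q v u) (hi : ∀ᶠ q in 𝓝 p, (g q).IsInvertible) :
    IsCurvatureTensor (fun u v ↦ g p u v) (curvature (leviCivita g) p) := by
  have hd : ∀ᶠ q in 𝓝 p, DifferentiableAt ℝ g q := by
    filter_upwards [hg.eventually (by simp)] with q hq using hq.differentiableAt two_ne_zero
  have hΓ := differentiableAt_leviCivita hg hi.self_of_nhds
  have hsym := leviCivita_symm hs hd
  have hsymp := hsym.self_of_nhds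
  have hDsym : ∀ u v w, fderiv ℝ (leviCivita g) p u v w = fderiv ℝ (leviCivita g) p u w v := by
    intro u v w
    rw [← fderiv_apply_apply hΓ, ← fderiv_apply_apply hΓ]
    have : fderiv ℝ (fun q ↦ leviCivita g q v w) p = fderiv ℝ (fun q ↦ leviCivita g q w v) p :=
      Filter.EventuallyEq.fderiv_eq (by filter_upwards [hsym] with y hy using hy v w)
    rw [this]
  have hc := leviCivita_compat hs hi hd
  have hcp := hc.self_of_nhds
  have hg1 : DifferentiableAt ℝ g p := hd.self_of_nhds
  have hg2 : DifferentiableAt ℝ (fderiv ℝ g) p :=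
    (hg.fderiv_right (m := 1) le_rfl).differentiableAt one_ne_zero
  have h2sym : ∀ u v, fderiv ℝ (fderiv ℝ g) p u v = fderiv ℝ (fderiv ℝ g) p v u :=
    hg.isSymmSndFDerivAt (by simp)
  -- Metric compatibility in the direction `v`, differentiated in the direction `u`.
  have hDc : ∀ u v w z, fderiv ℝ (fderiv ℝ g) p u v w z
      = g p (fderiv ℝ (leviCivita g) p u v w) z + fderiv ℝ g p u (leviCivita g p v w) z
        + (g p w (fderiv ℝ (leviCivita g) p u v z) + fderiv ℝ g p u w (leviCivita g p v z)) := by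
    intro u v w z
    have e : fderiv ℝ (fun q ↦ fderiv ℝ g q v w z) p
        = fderiv ℝ (fun q ↦ g q (leviCivita g q v w) z + g q w (leviCivita g q v z)) p :=
      Filter.EventuallyEq.fderiv_eq (by filter_upwards [hc] with y hy using (hy v w z).symm)
    have l : HasFDerivAt (fun q ↦ fderiv ℝ g q v w z) _ p :=
      ((hg2.hasFDerivAt.clm_apply (hasFDerivAt_const v p)).clm_apply
        (hasFDerivAt_const w p)).clm_apply (hasFDerivAt_const z p)
    have a : ∀ w, HasFDerivAt (fun q ↦ leviCivita g q v w) _ p := fun w ↦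
      ((hΓ.hasFDerivAt.clm_apply (hasFDerivAt_const v p)).clm_apply (hasFDerivAt_const w p))
    have r1 := ((hg1.hasFDerivAt.clm_apply (a w)).clm_apply (hasFDerivAt_const z p))
    have r2 := ((hg1.hasFDerivAt.clm_apply (hasFDerivAt_const w p)).clm_apply (a z))
    have r : HasFDerivAt (fun q ↦ g q (leviCivita g q v w) z + g q w (leviCivita g q v z)) _ p :=
      r1.add r2
    rw [l.fderiv, r.fderiv] at e
    have e' := congrArg (fun T ↦ T u) e
    simpa using e'
  constructor
  · intro u u' v
    simp [curvature]
    abel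
  · intro c u v
    simp [curvature]
    module
  · intro u v
    simp only [curvature]
    abel
  · intro u v w
    simp only [curvature, add_apply, sub_apply,
      ContinuousLinearMap.comp_apply]
    rw [hDsym u w v, hDsym v u w, hDsym w v u, hsymp u w, hsymp v u, hsymp w v]
    abel
  · intro u v w z
    -- Antisymmetrising `hDc` in `u`, `v` removes the second derivative of `g`. The remaining first
    -- derivatives of `g` are rewritten by compatibility, and the ΓΓ terms of the curvature appear.
    have e := h2sym u v
    have e1 := hDc u v w z
    have e2 := hDc v u w z
    rw [e] at e1
    have c1 := hcp u (leviCivita g p v w) z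
    have c2 := hcp u w (leviCivita g p v z)
    have c3 := hcp v (leviCivita g p u w) z
    have c4 := hcp v w (leviCivita g p u z)
    simp only [curvature, add_apply, sub_apply,
      ContinuousLinearMap.comp_apply, map_add, map_sub]
    linarith

/-- Pulling back reverses composition, so `act` is an anti-representation. This is why the dual
connection -`act` Γ has curvature -`act` R. -/
lemma act_comp (C D : E4 →L[ℝ] E4) (θ : TwoForm) :
    act C (act D θ) - act D (act C θ) = act (D ∘L C - C ∘L D) θ := by
  apply ext_ev
  intro u v
  simp only [ev_sub, act_ev, sub_apply, ContinuousLinearMap.comp_apply]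
  have hl : ∀ a b c, ev θ (a - b) c = ev θ a c - ev θ b c := by
    intro a b c
    exact LinearMap.map_sub₂ (toBilin θ) a b c
  have hr : ∀ a b c, ev θ a (b - c) = ev θ a b - ev θ a c := by
    intro a b c
    exact map_sub (toBilin θ a) b c
  rw [hl, hr]
  ring

lemma curvature_formConnection {Γ : E4 → E4 →L[ℝ] E4 →L[ℝ] E4} (hΓ : DifferentiableAt ℝ Γ p)
    (u v : E4) (θ : TwoForm) :
    curvature (formConnection Γ) p u v θ = -act (curvature Γ p u v) θ := by
  have h : fderiv ℝ (formConnection Γ) p = -(ContinuousLinearMap.compL ℝ E4 _ _ act ∘L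
      fderiv ℝ Γ p) := by
    have : HasFDerivAt (formConnection Γ) _ p :=
      (((ContinuousLinearMap.compL ℝ E4 _ _ act).hasFDerivAt).comp p hΓ.hasFDerivAt).neg
    exact this.fderiv
  have h1 : ∀ a b, fderiv ℝ (formConnection Γ) p a b θ = -act (fderiv ℝ Γ p a b) θ := by
    intro a b
    rw [h]
    rfl
  have h2 := act_comp (Γ p u) (Γ p v) θ
  simp only [curvature, add_apply, sub_apply,
    ContinuousLinearMap.comp_apply, h1, formConnection_apply, map_add, map_sub, map_neg] at h2 ⊢
  rw [neg_neg, neg_neg, h2]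
  abel

end Chart

/-! ### The metric and the frame in a chart -/

section ManifoldChart

lemma two_le_infty : (2 : WithTop ℕ∞) ≤ ((⊤ : ℕ∞) : WithTop ℕ∞) :=
  WithTop.coe_le_coe.2 (le_top : (2 : ℕ∞) ≤ ⊤)

variable {M : Type*} [TopologicalSpace M] [ChartedSpace E4 M]
  [IsManifold (𝓡 4) ((⊤ : ℕ∞) : WithTop ℕ∞) M]

/-- Constant fields of the chart are smooth sections of the tangent bundle, so their inner products,
the components of `chartMetric`, are smooth. -/
lemma contMDiffAt_mfderiv_chart_symm (x : M) (u : E4) :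
    ContMDiffAt (𝓡 4) ((𝓡 4).prod 𝓘(ℝ, E4)) ((⊤ : ℕ∞) : WithTop ℕ∞)
      (fun q : E4 ↦ (⟨(chartAt E4 x).symm q, mfderiv (𝓡 4) (𝓡 4) (chartAt E4 x).symm q u⟩ :
        TotalSpace E4 (TangentSpace (𝓡 4) : M → Type))) (chartAt E4 x x) := by
  have h := (contMDiffOn_chart_symm (I := 𝓡 4) (n := ((⊤ : ℕ∞) : WithTop ℕ∞))
    (x := x)).contMDiffOn_tangentMapWithin (m := ((⊤ : ℕ∞) : WithTop ℕ∞)) le_rfl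
    (chartAt E4 x).open_target.uniqueMDiffOn
  have hu : ContMDiff (𝓡 4) ((𝓡 4).prod 𝓘(ℝ, E4)) ((⊤ : ℕ∞) : WithTop ℕ∞)
      (fun q : E4 ↦ (⟨q, u⟩ : TangentBundle (𝓡 4) E4)) := by
    intro q
    exact contMDiffAt_vectorSpace_iff_contDiffAt.2 contDiffAt_const
  have ht : (chartAt E4 x).target ∈ 𝓝 (chartAt E4 x x) :=
    (chartAt E4 x).open_target.mem_nhds (mem_chart_target E4 x)
  have h2 := (h.comp (hu.contMDiffOn (s := (chartAt E4 x).target)) (fun q hq ↦ hq)).contMDiffAt ht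
  refine h2.congr_of_eventuallyEq ?_
  filter_upwards [ht] with q hq
  simp only [Function.comp, tangentMapWithin]
  rw [mfderivWithin_eq_mfderiv ((chartAt E4 x).open_target.uniqueMDiffOn q hq)
    ((contMDiffOn_chart_symm (I := 𝓡 4) (n := ((⊤ : ℕ∞) : WithTop ℕ∞))
    (x := x)).contMDiffAt ((chartAt E4 x).open_target.mem_nhds hq) |>.mdifferentiableAt (by simp))]

variable [RiemannianBundle (fun x : M ↦ TangentSpace (𝓡 4) x)]

omit [IsManifold (𝓡 4) ((⊤ : ℕ∞) : WithTop ℕ∞) M] in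
lemma chartMetric_apply (x : M) (q u v : E4) :
    chartMetric x q u v = inner ℝ (mfderiv (𝓡 4) (𝓡 4) (chartAt E4 x).symm q u)
      (mfderiv (𝓡 4) (𝓡 4) (chartAt E4 x).symm q v) := rfl

omit [IsManifold (𝓡 4) ((⊤ : ℕ∞) : WithTop ℕ∞) M] in
lemma chartMetric_symm (x : M) (q u v : E4) : chartMetric x q u v = chartMetric x q v u := by
  rw [chartMetric_apply, chartMetric_apply, real_inner_comm]

lemma clm_eq_sum (T : E4 →L[ℝ] E4 →L[ℝ] ℝ) :
    T = ∑ i, ∑ j, T (EuclideanSpace.single i 1) (EuclideanSpace.single j 1) •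
      ((EuclideanSpace.proj i : E4 →L[ℝ] ℝ).smulRight (EuclideanSpace.proj j : E4 →L[ℝ] ℝ)) := by
  have : ∀ w : E4, w = ∑ i, w i • EuclideanSpace.single i (1 : ℝ) := by
    intro w
    have := ((EuclideanSpace.basisFun (Fin 4) ℝ).sum_repr w).symm
    simpa using this
  ext u v
  conv_lhs => rw [this u, this v]
  simp only [map_sum, map_smul, sum_apply, smul_apply, ContinuousLinearMap.smulRight_apply,
    PiLp.proj_apply, smul_eq_mul, Finset.mul_sum]
  refine (Finset.sum_comm).trans ?_
  refine Finset.sum_congr rfl fun i _ ↦ Finset.sum_congr rfl fun j _ ↦ ?_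
  ring

lemma contDiffAt_chartMetric [IsContMDiffRiemannianBundle (𝓡 4) ((⊤ : ℕ∞) : WithTop ℕ∞) E4
      (fun x : M ↦ TangentSpace (𝓡 4) x)] (x : M) :
    ContDiffAt ℝ ((⊤ : ℕ∞) : WithTop ℕ∞) (chartMetric x) (chartAt E4 x x) := by
  have h : ∀ u v, ContDiffAt ℝ ((⊤ : ℕ∞) : WithTop ℕ∞) (fun q ↦ chartMetric x q u v)
      (chartAt E4 x x) := by
    intro u v
    have := (contMDiffAt_mfderiv_chart_symm x u).inner_bundle (contMDiffAt_mfderiv_chart_symm x v)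
    exact this.contDiffAt
  have e : chartMetric x = fun q ↦ ∑ i, ∑ j,
      chartMetric x q (EuclideanSpace.single i 1) (EuclideanSpace.single j 1) •
      ((EuclideanSpace.proj i : E4 →L[ℝ] ℝ).smulRight (EuclideanSpace.proj j : E4 →L[ℝ] ℝ)) :=
    funext fun q ↦ clm_eq_sum _
  rw [e]
  exact ContDiffAt.sum fun i _ ↦ ContDiffAt.sum fun j _ ↦ (h _ _).smul contDiffAt_const

lemma isInvertible_chartMetric (x : M) {q : E4} (hq : q ∈ (chartAt E4 x).target) :
    (chartMetric x q).IsInvertible := by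
  have hinj : Function.Injective (chartMetric x q) := by
    rw [injective_iff_map_eq_zero]
    intro u hu
    have h0 : chartMetric x q u u = 0 := by simp [hu]
    rw [chartMetric_apply, inner_self_eq_zero] at h0
    have := (mdifferentiable_chart (I := 𝓡 4) x).symm.mfderiv_injective hq
    exact this (h0.trans (map_zero _).symm)
  have hr : finrank ℝ E4 = finrank ℝ (E4 →L[ℝ] ℝ) :=
    (LinearMap.toContinuousLinearMap (𝕜 := ℝ) (E := E4) (F' := ℝ)).finrank_eq.symm.trans
      (Subspace.dual_finrank_eq (K := ℝ) (V := E4)) |>.symm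
  exact ⟨(LinearEquiv.ofInjectiveOfFinrankEq (chartMetric x q).toLinearMap hinj
    hr).toContinuousLinearEquiv, by ext; rfl⟩

lemma chartMetric_frame (o : ManifoldOrientation M) (x : M) (i j : Fin 4) :
    chartMetric x (chartAt E4 x x) (frame o x i) (frame o x j) = if i = j then 1 else 0 := by
  set B := Orientation.finOrthonormalBasis (E := TangentSpace (𝓡 4) x) (n := 4) (by norm_num)
    (finrank_euclideanSpace_fin (𝕜 := ℝ) (n := 4)) (o.orient x)
  have hB := orthonormal_iff_ite.1 B.orthonormal i j
  rw [← hB, chartMetric_apply]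
  have h1 : ∀ i, mfderiv (𝓡 4) (𝓡 4) (chartAt E4 x).symm (chartAt E4 x x) (frame o x i) = B i := by
    intro i
    have := (mdifferentiable_chart (I := 𝓡 4) x).symm_comp_deriv (mem_chart_source E4 x)
    exact congrArg (fun T ↦ T (B i)) this
  -- The base point `(chartAt E4 x).symm (chartAt E4 x x)` equals `x` only propositionally. The
  -- inner product is transported by generalising the point, and `id` fixes the fibre in which each
  -- vector is read.
  have h2 : ∀ (y : M) (_ : y = x) (a b : E4),
      (inner ℝ (id a : TangentSpace (𝓡 4) y) (id b : TangentSpace (𝓡 4) y) : ℝ)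
        = inner ℝ (id a : TangentSpace (𝓡 4) x) (id b : TangentSpace (𝓡 4) x) := by
    rintro y rfl a b
    rfl
  rw [h1 i, h1 j]
  exact h2 _ ((chartAt E4 x).left_inv (mem_chart_source E4 x)) (B i) (B j)

lemma frame_orientation (o : ManifoldOrientation M) (x : M) :
    (frame o x).orientation = Orientation.map (Fin 4) (chartDeriv x) (o.orient x) := by
  rw [frame, Basis.orientation_map]
  exact congrArg _ (Orientation.finOrthonormalBasis_orientation (E := TangentSpace (𝓡 4) x) _ _ _)

lemma eventually_isInvertible_chartMetric (x : M) :
    ∀ᶠ q in 𝓝 (chartAt E4 x x), (chartMetric x q).IsInvertible := by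
  filter_upwards [(chartAt E4 x).open_target.mem_nhds (mem_chart_target E4 x)] with q hq
    using isInvertible_chartMetric x hq

variable [IsContMDiffRiemannianBundle (𝓡 4) ((⊤ : ℕ∞) : WithTop ℕ∞) E4
  (fun x : M ↦ TangentSpace (𝓡 4) x)]

lemma isCurvatureTensor_riemann (x : M) :
    IsCurvatureTensor (fun u v ↦ chartMetric x (chartAt E4 x x) u v) (riemann x) :=
  isCurvatureTensor_leviCivita ((contDiffAt_chartMetric x).of_le two_le_infty)
    (Filter.Eventually.of_forall fun q ↦ chartMetric_symm x q)
    (eventually_isInvertible_chartMetric x)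

lemma plusCurvature_apply (o : ManifoldOrientation M) (x : M) (u v : E4) (θ : LambdaPlus o x) :
    (plusCurvature o x).1 u v θ = projPlus (frame o x) (-act (riemann x u v) θ.1) := by
  rw [riemann, ← curvature_formConnection (differentiableAt_leviCivita
    ((contDiffAt_chartMetric x).of_le two_le_infty)
    (eventually_isInvertible_chartMetric x).self_of_nhds)]
  rfl

lemma IsCurvatureTensor.coord_skew {h : E4 →L[ℝ] E4 →L[ℝ] ℝ} {R : E4 → E4 → E4 →L[ℝ] E4}
    (hR : IsCurvatureTensor (fun u v ↦ h u v) R) (b : Basis (Fin 4) ℝ E4)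
    (hb : ∀ i j, h (b i) (b j) = if i = j then 1 else 0) (u v : E4) (k l : Fin 4) :
    b.coord k (R u v (b l)) = -b.coord l (R u v (b k)) := by
  have h1 : ∀ w k, h w (b k) = b.coord k w := by
    intro w k
    conv_lhs => rw [← b.sum_repr w]
    simp [-Basis.sum_repr, hb]
  have h2 : ∀ w k, h (b k) w = b.coord k w := by
    intro w k
    conv_lhs => rw [← b.sum_repr w]
    simp [-Basis.sum_repr, hb]
  have := hR.skew u v (b l) (b k)
  rw [h1, h2] at this
  linarith

end ManifoldChart

/-! ### Definite subspaces of `Λ²` -/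

section WedgeDefinite

/-- `α ∧ β` as an alternating form. -/
def wedgeAlt (α β : TwoForm) : E4 [⋀^Fin 4]→ₗ[ℝ] ℝ where
  toFun := wedge22 α β
  map_update_add' := by
    intro inst m i x y
    obtain rfl : inst = instDecidableEqFin 4 := Subsingleton.elim _ _
    fin_cases i <;> simp [wedge22, Function.update, ev_add_left, ev_add_right] <;> ring
  map_update_smul' := by
    intro inst m i c x
    obtain rfl : inst = instDecidableEqFin 4 := Subsingleton.elim _ _
    fin_cases i <;> simp [wedge22, Function.update, ev_smul_left, ev_smul_right] <;> ring
  map_eq_zero_of_eq' := by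
    intro v i j hij hne
    have hs : ∀ i j, i < j → v i = v j → wedge22 α β v = 0 := by
      intro i j hlt h
      have sα := ev_swap α
      have sβ := ev_swap β
      fin_cases i <;> fin_cases j <;> simp at hlt <;> simp only [Fin.zero_eta, Fin.mk_one,
        Fin.reduceFinMk] at h <;> simp only [wedge22, h, ev_self]
      · ring
      · rw [sα (v 1) (v 2), sβ (v 1) (v 2)]; ring
      · rw [sα (v 1) (v 3), sβ (v 1) (v 3), sα (v 2) (v 3), sβ (v 2) (v 3)]; ring
      · ring
      · rw [sα (v 2) (v 3), sβ (v 2) (v 3)]; ring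
      · ring
    rcases lt_or_gt_of_ne hne with h | h
    · exact hs i j h hij
    · exact hs j i h hij.symm

@[simp] lemma wedgeAlt_apply (α β : TwoForm) (v : Fin 4 → E4) : wedgeAlt α β v = wedge22 α β v :=
  rfl

/-- Λ⁴ is one-dimensional. Wedge squares computed on one basis thus determine those on every other.
-/
lemma wedge22_eq_mul_det (α β : TwoForm) (b : Basis (Fin 4) ℝ E4) (v : Fin 4 → E4) :
    wedge22 α β v = wedge22 α β b * b.det v := by
  have h := AlternatingMap.congr_fun (AlternatingMap.eq_smul_basis_det b (wedgeAlt α β)) v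
  simpa using h

/-- The symmetric bilinear form `(α, β) ↦ (α ∧ β)(v)`. -/
def wedgeBilin (v : Fin 4 → E4) : LinearMap.BilinForm ℝ TwoForm :=
  LinearMap.mk₂ ℝ (fun α β ↦ wedge22 α β v)
    (by
      intro α α' β
      simp only [wedge22, ev_add]
      ring)
    (by
      intro c α β
      simp only [wedge22, ev_smul, smul_eq_mul]
      ring)
    (by
      intro α β β'
      simp only [wedge22, ev_add]
      ring)
    (by
      intro c α β
      simp only [wedge22, ev_smul, smul_eq_mul]
      ring)

@[simp] lemma wedgeBilin_apply (v : Fin 4 → E4) (α β : TwoForm) :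
    wedgeBilin v α β = wedge22 α β v := rfl

lemma wedge22_comm (α β : TwoForm) (v : Fin 4 → E4) : wedge22 α β v = wedge22 β α v := by
  simp only [wedge22]
  ring

lemma mem_selfDual_of_ev (b : Basis (Fin 4) ℝ E4) {θ : TwoForm}
    (h1 : ev θ (b 2) (b 3) = ev θ (b 0) (b 1)) (h2 : ev θ (b 1) (b 3) = -ev θ (b 0) (b 2))
    (h3 : ev θ (b 1) (b 2) = ev θ (b 0) (b 3)) : θ ∈ selfDual b := by
  rw [mem_selfDual]
  have h4 := ev_swap θ (b 3) (b 1)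
  apply ext_basis b <;> simp [hodge, cov2_ev, h1, h2, h3, h4]

lemma wedge22_self_selfDual (c : Basis (Fin 4) ℝ E4) {θ : TwoForm} (h : θ ∈ selfDual c) :
    wedge22 θ θ c = 2 * (ev θ (c 0) (c 1) ^ 2 + ev θ (c 0) (c 2) ^ 2 + ev θ (c 0) (c 3) ^ 2) := by
  obtain ⟨h1, h2, h3⟩ := selfDual_ev c h
  simp only [wedge22, h1, h2, h3]
  ring

lemma wedge22_self_antiSelfDual (c : Basis (Fin 4) ℝ E4) {θ : TwoForm} (h : θ ∈ antiSelfDual c) :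
    wedge22 θ θ c = -2 * (ev θ (c 0) (c 1) ^ 2 + ev θ (c 0) (c 2) ^ 2 + ev θ (c 0) (c 3) ^ 2) := by
  obtain ⟨h1, h2, h3⟩ := antiSelfDual_ev c h
  simp only [wedge22, h1, h2, h3]
  ring

lemma wedge22_self_pos (c : Basis (Fin 4) ℝ E4) {θ : TwoForm} (h : θ ∈ selfDual c) (h0 : θ ≠ 0) :
    0 < wedge22 θ θ c := by
  rw [wedge22_self_selfDual c h]
  by_contra hn
  have key : ∀ x y z : ℝ, ¬ 0 < 2 * (x ^ 2 + y ^ 2 + z ^ 2) → x = 0 ∧ y = 0 ∧ z = 0 := by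
    intro x y z h
    refine ⟨?_, ?_, ?_⟩ <;> apply (pow_eq_zero_iff two_ne_zero).1 <;>
      linarith [sq_nonneg x, sq_nonneg y, sq_nonneg z]
  obtain ⟨h1, h2, h3⟩ := key _ _ _ hn
  obtain ⟨e1, e2, e3⟩ := selfDual_ev c h
  have hz : ∀ u v, ev 0 u v = 0 := fun _ _ ↦ rfl
  apply h0
  apply ext_basis c <;> simp only [e1, e2, e3, h1, h2, h3, hz, neg_zero]

lemma finrank_selfDual (c : Basis (Fin 4) ℝ E4) : finrank ℝ (selfDual c) = 3 := by
  simp [finrank_eq_card_basis (plusBasis c)]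

/-- A subspace positive for `c` meets Λ⁻ of `c`, where the wedge square is nonpositive, only in 0.
It therefore projects injectively to Λ⁺ of `c`. -/
lemma IsWedgeDefinite.finrank_le {S : Submodule ℝ TwoForm} (hS : IsWedgeDefinite S) :
    finrank ℝ S ≤ 3 := by
  obtain ⟨c, hc⟩ := hS
  have hinj : Function.Injective (projPlus c ∘ₗ S.subtype) := by
    rw [injective_iff_map_eq_zero]
    rintro ⟨θ, hθ⟩ h
    have h0 : (1 / 2 : ℝ) • (θ + hodge c θ) = 0 := congrArg Subtype.val h
    have h1 : θ ∈ antiSelfDual c := by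
      rw [mem_antiSelfDual]
      rw [smul_eq_zero_iff_right (by norm_num)] at h0
      exact (neg_eq_of_add_eq_zero_right h0).symm
    by_contra hne
    have hp := hc θ hθ (fun h ↦ hne (Subtype.ext h))
    rw [wedge22_self_antiSelfDual c h1] at hp
    nlinarith [sq_nonneg (ev θ (c 0) (c 1)),
      sq_nonneg (ev θ (c 0) (c 2)), sq_nonneg (ev θ (c 0) (c 3))]
  exact (LinearMap.finrank_le_finrank_of_injective hinj).trans_eq (finrank_selfDual c)

/-- If the dimension is below 3, the pairing of Λ⁺ of `c` with `S` has a kernel for dimension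
reasons. A nonzero ν in it is positive and wedge-orthogonal to `S`, so adjoining ν keeps the
subspace definite, against maximality. The converse is the dimension bound. -/
theorem isMaximalDefinite_iff {S : Submodule ℝ TwoForm} :
    IsMaximalDefinite S ↔ IsWedgeDefinite S ∧ finrank ℝ S = 3 := by
  constructor
  · intro h
    refine ⟨h.1, ?_⟩
    by_contra hne
    have hlt : finrank ℝ S < 3 := lt_of_le_of_ne h.1.finrank_le hne
    obtain ⟨c, hc⟩ := h.1
    let L : selfDual c →ₗ[ℝ] Module.Dual ℝ S :=
      (S.subtype.dualMap) ∘ₗ (wedgeBilin c) ∘ₗ (selfDual c).subtype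
    have hker : LinearMap.ker L ≠ ⊥ := by
      intro hb
      have := LinearMap.finrank_le_finrank_of_injective (LinearMap.ker_eq_bot.1 hb)
      rw [finrank_selfDual, Subspace.dual_finrank_eq] at this
      omega
    obtain ⟨⟨ν, hν⟩, hνL, hν0⟩ := (Submodule.ne_bot_iff _).1 hker
    have hν0' : ν ≠ 0 := fun h ↦ hν0 (Subtype.ext h)
    have horth : ∀ s ∈ S, wedge22 ν s c = 0 := by
      intro s hs
      have := LinearMap.congr_fun (LinearMap.mem_ker.1 hνL) ⟨s, hs⟩
      exact this
    have hνpos := wedge22_self_pos c hν hν0'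
    have hdef : IsWedgeDefinite (S ⊔ Submodule.span ℝ {ν}) := by
      refine ⟨c, fun θ hθ h0 ↦ ?_⟩
      obtain ⟨s, hs, t, ht, rfl⟩ := Submodule.mem_sup.1 hθ
      obtain ⟨a, rfl⟩ := Submodule.mem_span_singleton.1 ht
      have e : wedge22 (s + a • ν) (s + a • ν) c = wedge22 s s c + a ^ 2 * wedge22 ν ν c := by
        have e1 := horth s hs
        have e2 : wedge22 (s + a • ν) (s + a • ν) c
            = wedge22 s s c + 2 * a * wedge22 ν s c + a ^ 2 * wedge22 ν ν c := by
          simp only [wedge22, ev_add, ev_smul]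
          ring
        rw [e2, e1]
        ring
      rw [e]
      by_cases hs0 : s = 0
      · have ha : a ≠ 0 := by
          rintro rfl
          exact h0 (by simp [hs0])
        have : wedge22 s s c = 0 := by
          rw [hs0]
          simp [wedge22, ev]
        rw [this, zero_add]
        positivity
      · have := hc s hs hs0
        positivity
    have hle := h.2 hdef le_sup_left
    have hνS : ν ∈ S := hle (Submodule.mem_sup_right (Submodule.mem_span_singleton_self ν))
    exact hνpos.ne' (horth ν hνS)
  · rintro ⟨h, h3⟩
    refine ⟨h, fun T hT hST ↦ ?_⟩
    exact (Submodule.eq_of_le_of_finrank_le hST (hT.finrank_le.trans h3.ge)).ge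

/-- Applying `ω i` with first argument `v 0` to a linear relation kills the `v 0` term and isolates
the coefficient of `v i.succ`. -/
lemma linearIndependent_of_ev {ω : Fin 3 → TwoForm} {v : Fin 4 → E4} {κ : ℝ} (hκ : κ ≠ 0)
    (h0 : v 0 ≠ 0) (hv : ∀ i j : Fin 3, ev (ω i) (v 0) (v j.succ) = if i = j then κ else 0) :
    LinearIndependent ℝ v := by
  rw [Fintype.linearIndependent_iff]
  intro g hg
  have hs : ∀ i : Fin 3, g i.succ = 0 := by
    intro i
    have e : toBilin (ω i) (v 0) (∑ i, g i • v i) = 0 := by rw [hg, map_zero]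
    rw [Fin.sum_univ_succ] at e
    simp only [map_add, map_smul, map_sum, toBilin_apply, ev_self, hv, smul_eq_mul] at e
    simpa [hκ] using e
  intro i
  refine Fin.cases ?_ hs i
  rw [Fin.sum_univ_succ] at hg
  simpa [hs, h0] using hg

/-- The value 2 is the wedge square of the forms `plusForm` on their own frame. -/
lemma exists_wedge_orthonormal_basis {S : Submodule ℝ TwoForm} {c : Basis (Fin 4) ℝ E4}
    (hc : ∀ θ ∈ S, θ ≠ 0 → 0 < wedge22 θ θ c) (h3 : finrank ℝ S = 3) :
    ∃ ω : Basis (Fin 3) ℝ S, ∀ i j, wedge22 (ω i) (ω j) c = if i = j then 2 else 0 := by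
  obtain ⟨v, hv⟩ := LinearMap.BilinForm.exists_orthogonal_basis
    (B := (wedgeBilin c).restrict S) ⟨fun α β ↦ wedge22_comm _ _ _⟩
  let w := v.reindex (finCongr h3)
  have hw : ∀ i j, i ≠ j → wedge22 (w i) (w j) c = 0 := by
    intro i j hij
    have := hv (i := (finCongr h3).symm i) (j := (finCongr h3).symm j) (by simpa using hij)
    simpa [w] using this
  have hpos : ∀ i, 0 < wedge22 (w i) (w i) c := fun i ↦
    hc _ (w i).2 (fun h ↦ w.ne_zero i (Subtype.ext h))
  have hr : ∀ i, IsUnit (√(2 / wedge22 (w i) (w i) c)) := fun i ↦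
    (Real.sqrt_ne_zero'.2 (div_pos two_pos (hpos i))).isUnit
  refine ⟨w.isUnitSMul hr, fun i j ↦ ?_⟩
  have e : ∀ (a b : ℝ) (α β : TwoForm), wedge22 (a • α) (b • β) c = a * b * wedge22 α β c := by
    intro a b α β
    simp only [wedge22, ev_smul]
    ring
  rw [Basis.isUnitSMul_apply, Basis.isUnitSMul_apply, Submodule.coe_smul, Submodule.coe_smul, e]
  split_ifs with hij
  · subst hij
    rw [Real.mul_self_sqrt (div_pos two_pos (hpos i)).le, div_mul_cancel₀ _ (hpos i).ne']
  · rw [hw i j hij, mul_zero]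

/-- This is the correspondence between definite 3-planes in Λ² and oriented conformal structures. A
frame adapted to a wedge-orthonormal basis `ω` of `S` is built from one vector `b 0` and the vectors
dual to the contractions of `ω` with it. -/
theorem exists_selfDual_eq {S : Submodule ℝ TwoForm} (hS : IsWedgeDefinite S)
    (h3 : finrank ℝ S = 3) : ∃ c : Basis (Fin 4) ℝ E4, S = selfDual c := by
  obtain ⟨b, hb⟩ := hS
  obtain ⟨ω, hω⟩ := exists_wedge_orthonormal_basis hb h3
  let L : E4 →ₗ[ℝ] (Fin 3 → ℝ) := LinearMap.pi fun i ↦ toBilin (ω i).1 (b 0)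
  have hL : LinearMap.range L = ⊤ := by
    by_contra hne
    -- A functional vanishing on the range yields a form θ in `S` with θ(b 0, ·) = 0. Then θ ∧ θ =
    -- 0, so θ = 0 by definiteness.
    obtain ⟨f, hf, hle⟩ := Submodule.exists_le_ker_of_lt_top _ (lt_top_iff_ne_top.2 hne)
    have hf' : ∀ u, ∑ i, f (Pi.single i 1) * ev (ω i).1 (b 0) u = 0 := by
      intro u
      have h1 : f (L u) = 0 := hle (LinearMap.mem_range_self L u)
      rw [LinearMap.pi_apply_eq_sum_univ f (L u)] at h1
      rw [← h1]
      refine Finset.sum_congr rfl fun i _ ↦ ?_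
      simp only [smul_eq_mul, L, LinearMap.pi_apply, toBilin_apply]
      rw [mul_comm]
      congr 2
      ext j
      simp [Pi.single_apply, eq_comm]
    let θ : S := ∑ i, f (Pi.single i 1) • ω i
    have hθ : ∀ u, ev θ.1 (b 0) u = 0 := by
      intro u
      rw [← hf' u]
      simp [θ, Fin.sum_univ_three]
    have hθ0 : θ = 0 := by
      by_contra h0
      have := hb θ.1 θ.2 (fun h ↦ h0 (Subtype.ext h))
      simp [wedge22, hθ] at this
    have hf0 : ∀ i, f (Pi.single i 1) = 0 := Fintype.linearIndependent_iff.1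
      ω.linearIndependent _ hθ0
    exact hf (LinearMap.pi_ext' fun i ↦ LinearMap.ext_ring (by simpa using hf0 i))
  choose d hd using fun j : Fin 3 ↦ LinearMap.range_eq_top.1 hL (Pi.single j 1)
  have hd' : ∀ i j, ev (ω i).1 (b 0) (d j) = if i = j then 1 else 0 := by
    intro i j
    have := congrFun (hd j) i
    simpa [L, Pi.single_apply] using this
  have hd'' : ∀ i j, ev (ω i).1 (d j) (b 0) = -if i = j then 1 else 0 := by
    intro i j
    rw [ev_swap, hd']
  have hli : LinearIndependent ℝ ![b 0, d 0, d 1, d 2] := by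
    refine linearIndependent_of_ev (ω := fun i ↦ (ω i).1) one_ne_zero (b.ne_zero 0) ?_
    intro i j
    fin_cases j <;> exact hd' i _
  set μ := b.det ![b 0, d 0, d 1, d 2] with hμ
  have hμ0 : μ ≠ 0 := by
    have := (Basis.is_basis_iff_det b (v := ![b 0, d 0, d 1, d 2])).1
      ⟨hli, hli.span_eq_top_of_card_eq_finrank' (by simp)⟩
    exact this.ne_zero
  have hm : ∀ i j, wedge22 (ω i).1 (ω j).1 ![b 0, d 0, d 1, d 2]
      = if i = j then 2 * μ else 0 := by
    intro i j
    rw [wedge22_eq_mul_det _ _ b, hω]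
    split_ifs <;> simp [hμ]
  -- The scaling factors are chosen so that the frame `v` below satisfies `b.det v = 1`, whichever
  -- sign `μ` has.
  obtain ⟨σ, hσ, l, hl, hlμ⟩ : ∃ σ : ℝ, σ * σ = 1 ∧ ∃ l : ℝ, l ≠ 0 ∧ l * l * μ = σ := by
    refine ⟨SignType.sign μ, ?_, √(1 / |μ|), ?_, ?_⟩
    · rcases lt_or_gt_of_ne hμ0 with h | h <;> simp [h]
    · exact Real.sqrt_ne_zero'.2 (by positivity)
    · rw [Real.mul_self_sqrt (by positivity)]
      rcases lt_or_gt_of_ne hμ0 with h | h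
      · simp [h, abs_of_neg, div_neg, hμ0]
      · simp [h, abs_of_pos, hμ0]
  have hσ0 : σ ≠ 0 := by
    rintro rfl
    simp at hσ
  -- With N i j = ω i (d (j+1), d (j+2)), indices mod 3, the wedge relations say N + Nᵀ = 2μ. Only
  -- the skew part of N obstructs self-duality. It has three entries, and replacing `d j` by `d j +
  -- t j • b 0` removes them.
  let t : Fin 3 → ℝ := ![ev (ω 2).1 (d 2) (d 0), -ev (ω 2).1 (d 1) (d 2), ev (ω 1).1 (d 1) (d 2)]
  let v : Fin 4 → E4 := ![l⁻¹ • b 0, (σ * l) • (d 0 + t 0 • b 0), (σ * l) • (d 1 + t 1 • b 0),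
    (σ * l) • (d 2 + t 2 • b 0)]
  have hv0 : ∀ i j : Fin 3, ev (ω i).1 (v 0) (v j.succ) = if i = j then σ else 0 := by
    intro i j
    have : ev (ω i).1 (l⁻¹ • b 0) ((σ * l) • (d j + t j • b 0)) = if i = j then σ else 0 := by
      rw [ev_smul_left, ev_smul_right, ev_add_right, ev_smul_right, ev_self, hd']
      split_ifs
      · field_simp
        ring
      · ring
    fin_cases j <;> exact this
  have hvl : LinearIndependent ℝ v := by
    refine linearIndependent_of_ev (ω := fun i ↦ (ω i).1) hσ0 ?_ hv0
    simpa [v, hl] using b.ne_zero 0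
  let c : Basis (Fin 4) ℝ E4 := basisOfLinearIndependentOfCardEqFinrank hvl (by simp)
  have hc : ∀ i, c i = v i := fun i ↦ by simp [c]
  have hvv : ∀ (i j k : Fin 3), ev (ω i).1 (v j.succ) (v k.succ)
      = l * l * (ev (ω i).1 (d j) (d k) + (if i = j then -t k else 0)
          + (if i = k then t j else 0)) := by
    intro i j k
    have : ev (ω i).1 ((σ * l) • (d j + t j • b 0)) ((σ * l) • (d k + t k • b 0))
      = l * l * (ev (ω i).1 (d j) (d k) + (if i = j then -t k else 0)
          + (if i = k then t j else 0)) := by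
      rw [ev_smul_left, ev_smul_right]
      simp only [ev_add_left, ev_add_right, ev_smul_left, ev_smul_right, hd', hd'', ev_self]
      have : ∀ x : ℝ, σ * l * (σ * l * x) = σ * σ * (l * l * x) := fun x ↦ by ring
      rw [this, hσ]
      split_ifs <;> ring
    fin_cases j <;> fin_cases k <;> exact this
  have hmem : ∀ i, (ω i).1 ∈ selfDual c := by
    intro i
    have m00 := hm 0 0
    have m01 := hm 0 1
    have m02 := hm 0 2
    have m11 := hm 1 1
    have m12 := hm 1 2
    have m22 := hm 2 2
    have s20 : ∀ i, ev (ω i).1 (d 0) (d 2) = -ev (ω i).1 (d 2) (d 0) := fun i ↦ ev_swap _ _ _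
    simp [wedge22, hd', s20] at m00 m01 m02 m11 m12 m22
    have e01 := hv0 i 0
    have e02 := hv0 i 1
    have e03 := hv0 i 2
    have e12 := hvv i 0 1
    have e13 := hvv i 0 2
    have e23 := hvv i 1 2
    have e31 := ev_swap (ω i).1 (v 3) (v 1)
    simp only [Fin.succ_zero_eq_one, Fin.succ_one_eq_two, show (2 : Fin 3).succ = 3 from rfl]
      at e01 e02 e03 e12 e13 e23
    apply mem_selfDual_of_ev <;> simp only [hc, e01, e02, e03, e12, e13, e23] <;>
      clear e01 e02 e03 e12 e13 e23 <;> rw [← hlμ] <;> fin_cases i <;>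
      simp [t, s20, hl] <;> linarith
  have hle : S ≤ selfDual c := by
    intro θ hθ
    have h2 : θ = ∑ i, ω.repr ⟨θ, hθ⟩ i • (ω i).1 := by
      have := congrArg S.subtype (ω.sum_repr ⟨θ, hθ⟩)
      rw [map_sum] at this
      exact this.symm
    rw [h2]
    exact Submodule.sum_mem _ fun i _ ↦ Submodule.smul_mem _ _ (hmem i)
  exact ⟨c, Submodule.eq_of_le_of_finrank_eq hle (h3.trans (finrank_selfDual c).symm)⟩

end WedgeDefinite

/-! ### The Lie algebra `𝔰𝔬(3)` -/

section Skew

/-- The matrix of `y ↦ x × y`. -/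
def crossMatrix (x : Fin 3 → ℝ) : Matrix (Fin 3) (Fin 3) ℝ :=
  !![0, -x 2, x 1; x 2, 0, -x 0; -x 1, x 0, 0]

variable {W : Type*} [AddCommGroup W] [Module ℝ W] {B : LinearMap.BilinForm ℝ W}
  (e : Basis (Fin 3) ℝ W)

/-- The endomorphism `y ↦ x × y` in the basis `e`. -/
def soEnd (x : Fin 3 → ℝ) : Module.End ℝ W := Matrix.toLin e e (crossMatrix x)

lemma soEnd_apply (x : Fin 3 → ℝ) (a : Fin 3) :
    soEnd e x (e a) = ∑ c, crossMatrix x c a • e c := by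
  simp [soEnd, Matrix.toLin_self]

/-- In cross-product coordinates the invariant inner product -tr(ξ η)/2 is the dot product. -/
lemma trace_soEnd_mul (x y : Fin 3 → ℝ) :
    LinearMap.trace ℝ W (soEnd e x * soEnd e y) = -2 * (x ⬝ᵥ y) := by
  rw [LinearMap.trace_eq_matrix_trace ℝ e, LinearMap.toMatrix_mul, soEnd, soEnd,
    LinearMap.toMatrix_toLin, LinearMap.toMatrix_toLin]
  simp [crossMatrix, Matrix.trace, Fin.sum_univ_three, dotProduct]
  ring

/-- The commutator of two cross products is the cross product with x 0 × x 1, so the trace is a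
multiple of the triple product. -/
lemma trace_soEnd_commutator (x : Fin 3 → Fin 3 → ℝ) :
    LinearMap.trace ℝ W ((soEnd e (x 0) * soEnd e (x 1) - soEnd e (x 1) * soEnd e (x 0))
      * soEnd e (x 2)) = -2 * (Matrix.of x).det := by
  rw [LinearMap.trace_eq_matrix_trace ℝ e, LinearMap.toMatrix_mul, map_sub,
    LinearMap.toMatrix_mul, LinearMap.toMatrix_mul]
  simp only [soEnd, LinearMap.toMatrix_toLin]
  simp [crossMatrix, Matrix.trace, Fin.sum_univ_three, Matrix.det_fin_three]
  ring

variable (he : ∀ i j, B (e i) (e j) = if i = j then 2 else 0)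
include he

lemma soEnd_mem (x : Fin 3 → ℝ) : soEnd e x ∈ skewAdjointLieSubalgebra B := by
  have h : B ∘ₗ soEnd e x = -B.compl₂ (soEnd e x) := by
    refine LinearMap.ext_basis e e fun i j ↦ ?_
    simp [soEnd_apply, he, crossMatrix]
    fin_cases i <;> fin_cases j <;> simp
  refine (LinearMap.mem_skewAdjointSubmodule _).2 fun α β ↦ ?_
  have := LinearMap.congr_fun₂ h α β
  simpa using this

lemma exists_soEnd_eq (ξ : skewAdjointLieSubalgebra B) : ∃ x, ξ.1 = soEnd e x := by
  set N := LinearMap.toMatrix e e ξ.1 with hN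
  have hξ : ∀ a, ξ.1 (e a) = ∑ c, N c a • e c := by
    intro a
    rw [hN, ← e.sum_repr (ξ.1 (e a))]
    simp [LinearMap.toMatrix_apply]
  have hs := (LinearMap.mem_skewAdjointSubmodule _).1 ξ.2
  have hskew : ∀ i j, N i j = -N j i := by
    intro i j
    have h : B (ξ.1 (e j)) (e i) = B (e j) (-ξ.1 (e i)) := hs (e j) (e i)
    rw [hξ, hξ] at h
    simp [he] at h
    linarith
  refine ⟨![N 2 1, N 0 2, N 1 0], ?_⟩
  have hNx : N = crossMatrix ![N 2 1, N 0 2, N 1 0] := by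
    ext i j
    have h0 := hskew 0 0
    have h1 := hskew 1 1
    have h2 := hskew 2 2
    fin_cases i <;> fin_cases j <;> simp [crossMatrix] <;>
      first | linarith | exact hskew _ _
  rw [soEnd, ← hNx, hN, Matrix.toLin_toMatrix]

/-- The element `y ↦ x × y` of `𝔰𝔬(W)`. -/
def soElt (x : Fin 3 → ℝ) : skewAdjointLieSubalgebra B := ⟨soEnd e x, soEnd_mem e he x⟩

lemma exists_soElt (ξ : skewAdjointLieSubalgebra B) : ∃ x, ξ = soElt e he x := by
  obtain ⟨x, hx⟩ := exists_soEnd_eq e he ξ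
  exact ⟨x, Subtype.ext hx⟩

lemma soVolume_soElt (x : Fin 3 → Fin 3 → ℝ) :
    soVolume (soElt e he (x 0)) (soElt e he (x 1)) (soElt e he (x 2)) = 2 * (Matrix.of x).det := by
  have h := trace_soEnd_commutator e x
  change -LinearMap.trace ℝ W ((soEnd e (x 0) * soEnd e (x 1) - soEnd e (x 1) * soEnd e (x 0))
      * soEnd e (x 2)) = _
  rw [h]
  ring

variable {e} {Φ : EndForm W} {τ : Fin 3 → TwoForm}
  (hΦ : ∀ u v, Φ.1 u v = soEnd e fun a ↦ ev (τ a) u v)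
include hΦ

lemma curvatureMap_soElt (x : Fin 3 → ℝ) :
    curvatureMap B Φ (soElt e he x) = Fintype.linearCombination ℝ τ x := by
  apply ext_ev
  intro u v
  rw [curvatureMap_ev, hΦ, soElt, trace_soEnd_mul]
  simp [Fintype.linearCombination_apply, dotProduct, Fin.sum_univ_three]

lemma range_curvatureMap :
    LinearMap.range (curvatureMap B Φ) = LinearMap.range (Fintype.linearCombination ℝ τ) := by
  ext θ
  constructor
  · rintro ⟨ξ, rfl⟩
    obtain ⟨x, rfl⟩ := exists_soElt e he ξ
    exact ⟨x, (curvatureMap_soElt he hΦ x).symm⟩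
  · rintro ⟨x, rfl⟩
    exact ⟨_, curvatureMap_soElt he hΦ x⟩

omit he in
lemma pontrjagin_eq_sum (v : Fin 4 → E4) : pontrjagin Φ v = 2 * ∑ a, wedge22 (τ a) (τ a) v := by
  rw [pontrjagin, map_add, map_sub]
  simp only [hΦ, trace_soEnd_mul, dotProduct, Fin.sum_univ_three, wedge22]
  ring

end Skew

/-! ### The natural orientation of a space of self-dual forms -/

section LieVolume

variable (c : Basis (Fin 4) ℝ E4)

/-- The coordinates of a self-dual form in `plusForm` are minus its values on (c 0, c j.succ),
whence the sign. The 4 is ⟨[f₀, f₁], f₂⟩ = 2|f₂|². -/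
lemma lieVolume_eq_det {ω : Fin 3 → TwoForm} (hω : ∀ i, ω i ∈ selfDual c) :
    lieVolume c (ω 0) (ω 1) (ω 2)
      = -4 * (Matrix.of fun i j : Fin 3 ↦ ev (ω i) (c 0) (c j.succ)).det := by
  have hs := fun i ↦ selfDual_ev c (hω i)
  have h10 := fun i ↦ ev_swap (ω i) (c 1) (c 0)
  have h20 := fun i ↦ ev_swap (ω i) (c 2) (c 0)
  have h30 := fun i ↦ ev_swap (ω i) (c 3) (c 0)
  have h21 := fun i ↦ ev_swap (ω i) (c 2) (c 1)
  have h31 := fun i ↦ ev_swap (ω i) (c 3) (c 1)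
  have h32 := fun i ↦ ev_swap (ω i) (c 3) (c 2)
  rw [lieVolume, formInner_apply, Matrix.det_fin_three]
  simp only [Fin.sum_univ_four, bracket_ev, ev_self, h10, h20, h30, h21, h31, h32,
    (hs _).1, (hs _).2.1, (hs _).2.2, Matrix.of_apply, Fin.succ_zero_eq_one, Fin.succ_one_eq_two,
    show (2 : Fin 3).succ = 3 from rfl]
  ring

lemma selfDual_ev_eq {θ : TwoForm} (hθ : θ ∈ selfDual c) (u v : E4) :
    ev θ u v = -∑ j : Fin 3, ev θ (c 0) (c j.succ) * ev (plusForm c j) u v := by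
  have h : θ = -∑ j : Fin 3, ev θ (c 0) (c j.succ) • plusForm c j := by
    obtain ⟨h1, h2, h3⟩ := selfDual_ev c hθ
    apply ext_basis c <;> simp [Fin.sum_univ_three, plusForm, cov2_ev, h1, h2, h3]
  conv_lhs => rw [h]
  simp [Fin.sum_univ_three]

/-- For the metric of `c`, the covector of `v 0` and the three contractions of `plusForm` with `v 0`
are orthogonal of equal length |v 0|, as for the unit quaternions. Their 4 × 4 determinant is -|v
0|⁴. On `v` its first column is (|v 0|², 0, 0, 0), which leaves the 3 × 3 determinant. The proof
expands both sides in coordinates. -/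
lemma det_plusForm (v : Fin 4 → E4) :
    (Matrix.of fun i j : Fin 3 ↦ ev (plusForm c i) (v 0) (v j.succ)).det
      = -(∑ i, c.coord i (v 0) ^ 2) * c.det v := by
  have h0 : ∀ u w, ev (plusForm c 0) u w = -((c.coord 0 u * c.coord 1 w - c.coord 0 w * c.coord 1 u)
      + (c.coord 2 u * c.coord 3 w - c.coord 2 w * c.coord 3 u)) := by
    simp [plusForm, cov2, wedge_ev, coframe]
  have h1 : ∀ u w, ev (plusForm c 1) u w = -((c.coord 0 u * c.coord 2 w - c.coord 0 w * c.coord 2 u)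
      + (c.coord 3 u * c.coord 1 w - c.coord 3 w * c.coord 1 u)) := by
    simp [plusForm, cov2, wedge_ev, coframe]
  have h2 : ∀ u w, ev (plusForm c 2) u w = -((c.coord 0 u * c.coord 3 w - c.coord 0 w * c.coord 3 u)
      + (c.coord 1 u * c.coord 2 w - c.coord 1 w * c.coord 2 u)) := by
    simp [plusForm, cov2, wedge_ev, coframe]
  rw [Basis.det_apply, Matrix.det_fin_three, Matrix.det_succ_row_zero]
  simp only [Fin.sum_univ_four, Matrix.det_fin_three, Matrix.of_apply, Matrix.submatrix_apply,
    Basis.toMatrix_apply, h0, h1, h2, Basis.coord_apply,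
    Fin.succ_zero_eq_one, Fin.succ_one_eq_two, show (2 : Fin 3).succ = 3 from rfl]
  simp [Fin.succAbove]
  ring

/-- The sign of `lieVolume` on the self-dual forms of `c` in terms of another basis `b`. -/
lemma exists_lieVolume_eq (b : Basis (Fin 4) ℝ E4) :
    ∃ k : ℝ, 0 < k ∧ ∀ ω : Fin 3 → TwoForm, (∀ i, ω i ∈ selfDual c) →
      lieVolume c (ω 0) (ω 1) (ω 2)
        = -(k * c.det b * (Matrix.of fun i j : Fin 3 ↦ ev (ω i) (b 0) (b j.succ)).det) := by
  set n := ∑ i, c.coord i (b 0) ^ 2 with hn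
  have hn0 : 0 < n := by
    refine lt_of_le_of_ne (Finset.sum_nonneg fun i _ ↦ sq_nonneg _) fun h ↦ b.ne_zero 0 ?_
    have h0 := (Finset.sum_eq_zero_iff_of_nonneg fun i _ ↦ sq_nonneg (c.coord i (b 0))).1 h.symm
    refine c.ext_elem fun i ↦ ?_
    simpa using h0 i (Finset.mem_univ i)
  have hd : c.det b ≠ 0 := (c.isUnit_det b).ne_zero
  -- The determinants of contractions with `b 0` and with `c 0` differ by the factor `n * c.det b`.
  -- The square keeps `k` positive and leaves the orientation of `b` relative to `c` as an explicit
  -- factor.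
  refine ⟨4 / (n * c.det b ^ 2), by positivity, fun ω hω ↦ ?_⟩
  have e : (Matrix.of fun i j : Fin 3 ↦ ev (ω i) (b 0) (b j.succ))
      = -((Matrix.of fun i j : Fin 3 ↦ ev (ω i) (c 0) (c j.succ))
        * (Matrix.of fun i j : Fin 3 ↦ ev (plusForm c i) (b 0) (b j.succ))) := by
    ext i j
    simp only [Matrix.of_apply, Matrix.neg_apply, Matrix.mul_apply]
    exact selfDual_ev_eq c (hω i) _ _
  rw [lieVolume_eq_det c hω, e, Matrix.det_neg, Matrix.det_mul, det_plusForm, ← hn]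
  simp only [Fintype.card_fin]
  field_simp

end LieVolume

/-! ### A pair of `3 × 3` matrices -/

section Matrices

open Matrix

lemma real_dotProduct_self_nonneg (x : Fin 3 → ℝ) : 0 ≤ x ⬝ᵥ x :=
  Finset.sum_nonneg fun i _ ↦ mul_self_nonneg (x i)

lemma mul_neg_iff_of_pos {q d : ℝ} (hq : 0 < q) : q * d < 0 ↔ d < 0 := by
  rw [← neg_pos, ← mul_neg, mul_pos_iff_of_pos_left hq, neg_pos]

/-- The segment A - sB, 0 ≤ s ≤ 1, contains no singular matrix: A x = sB x would give |A x| ≤ |B x|.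
So the determinant keeps its sign from A to A - B. -/
lemma det_mul_det_sub_pos {A B : Matrix (Fin 3) (Fin 3) ℝ}
    (h : ∀ x ≠ 0, (B *ᵥ x) ⬝ᵥ (B *ᵥ x) < (A *ᵥ x) ⬝ᵥ (A *ᵥ x)) : 0 < A.det * (A - B).det := by
  let f : ℝ → ℝ := fun s ↦ (A - s • B).det
  have hf : Continuous f := by fun_prop
  have hne : ∀ s ∈ Set.Icc (0 : ℝ) 1, f s ≠ 0 := by
    rintro s ⟨hs0, hs1⟩ h0
    obtain ⟨x, hx, hx0⟩ := exists_mulVec_eq_zero_iff.2 h0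
    have e : A *ᵥ x = s • (B *ᵥ x) := by
      rw [sub_mulVec, smul_mulVec, sub_eq_zero] at hx0
      exact hx0
    have hlt := h x hx
    rw [e, smul_dotProduct, dotProduct_smul, smul_eq_mul, smul_eq_mul] at hlt
    have hb := real_dotProduct_self_nonneg (B *ᵥ x)
    nlinarith [mul_nonneg hs0 hs0, mul_le_one₀ hs1 hs0 hs1]
  have e0 : f 0 = A.det := by simp [f]
  have e1 : f 1 = (A - B).det := by simp [f]
  rw [← e0, ← e1]
  by_contra hn
  have hmem : (0 : ℝ) ∈ Set.uIcc (f 0) (f 1) := by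
    rw [Set.mem_uIcc]
    rcases le_total (f 0) 0 with h0 | h0
    · rcases le_or_gt 0 (f 1) with h1 | h1
      · exact Or.inl ⟨h0, h1⟩
      · have := lt_of_le_of_ne h0 (hne 0 (by simp))
        exact absurd (mul_pos_of_neg_of_neg this h1) hn
    · rcases le_or_gt (f 1) 0 with h1 | h1
      · exact Or.inr ⟨h1, h0⟩
      · have := lt_of_le_of_ne h0 (hne 0 (by simp)).symm
        exact absurd (mul_pos this h1) hn
  obtain ⟨s, hs, hs0⟩ := intermediate_value_uIcc hf.continuousOn hmem
  rw [Set.uIcc_of_le zero_le_one] at hs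
  exact hne s hs hs0

end Matrices

/-! ### Curvature maps given by a pair of matrices -/

section Pair

open Matrix

variable (b : Basis (Fin 4) ℝ E4) (A B : Matrix (Fin 3) (Fin 3) ℝ)

/-- The `2`-form with coordinates `x` in `plusForm` and `y` in `minusForm`. -/
def formOf (x y : Fin 3 → ℝ) : TwoForm := ∑ i, x i • plusForm b i + ∑ i, y i • minusForm b i

/-- The images `∑ A c a • plusForm c + ∑ B c a • minusForm c` of the basis vectors under the map
`Λ⁺ → Λ⁺ ⊕ Λ⁻` with matrices `A`, `B`. -/
def pairForm (a : Fin 3) : TwoForm := formOf b (A.col a) (B.col a)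

lemma linearCombination_pairForm (x : Fin 3 → ℝ) :
    Fintype.linearCombination ℝ (pairForm b A B) x = formOf b (A *ᵥ x) (B *ᵥ x) := by
  simp only [Fintype.linearCombination_apply, pairForm, formOf, Fin.sum_univ_three, mulVec,
    dotProduct, Matrix.col_apply]
  module

/-- Contraction with `b 0` identifies both Λ⁺ and Λ⁻ with ℝ³, with opposite signs in the chosen
bases. The difference of the two matrices enters the sign through this identity. -/
lemma ev_formOf_zero (x y : Fin 3 → ℝ) (j : Fin 3) :
    ev (formOf b x y) (b 0) (b j.succ) = y j - x j := by
  fin_cases j <;> simp [formOf, Fin.sum_univ_three, plusForm, minusForm, cov2_ev] <;> ring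

lemma wedge22_formOf (x y : Fin 3 → ℝ) :
    wedge22 (formOf b x y) (formOf b x y) b = 2 * (x ⬝ᵥ x - y ⬝ᵥ y) := by
  simp [wedge22, formOf, Fin.sum_univ_three, plusForm, minusForm, cov2_ev, dotProduct]
  ring

/-- The quadratic form `|A x|² - |B x|²`. -/
def pairQuad (x : Fin 3 → ℝ) : ℝ := (A *ᵥ x) ⬝ᵥ (A *ᵥ x) - (B *ᵥ x) ⬝ᵥ (B *ᵥ x)

lemma wedge22_linearCombination (v : Fin 4 → E4) (x : Fin 3 → ℝ) :
    wedge22 (Fintype.linearCombination ℝ (pairForm b A B) x)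
      (Fintype.linearCombination ℝ (pairForm b A B) x) v = 2 * pairQuad A B x * b.det v := by
  rw [wedge22_eq_mul_det _ _ b, linearCombination_pairForm, wedge22_formOf, pairQuad]

lemma linearCombination_single (τ : Fin 3 → TwoForm) (a : Fin 3) :
    Fintype.linearCombination ℝ τ (Pi.single a 1) = τ a := by
  simp

lemma exists_basis_neg : ∃ c : Basis (Fin 4) ℝ E4, b.det c < 0 := by
  refine ⟨b.reindex (Equiv.swap 0 1), ?_⟩
  have h := b.det.map_swap b (i := 0) (j := 1) (by decide)
  rw [b.det_self] at h
  have e : (b.reindex (Equiv.swap 0 1) : Fin 4 → E4) = b ∘ Equiv.swap 0 1 := by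
    ext i : 1
    simp
  rw [e, h]
  norm_num

variable {A B}

lemma injective_of_pairQuad (h : ∀ x ≠ 0, pairQuad A B x ≠ 0) :
    Function.Injective (Fintype.linearCombination ℝ (pairForm b A B)) := by
  rw [injective_iff_map_eq_zero]
  intro x hx
  by_contra hne
  have := wedge22_linearCombination b A B b x
  rw [hx, b.det_self] at this
  have hz : ∀ u v, ev 0 u v = 0 := fun _ _ ↦ rfl
  simp only [wedge22, hz] at this
  exact h x hne (by linarith)

theorem isMaximalDefinite_pair_iff :
    IsMaximalDefinite (LinearMap.range (Fintype.linearCombination ℝ (pairForm b A B))) ↔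
      (∀ x ≠ 0, 0 < pairQuad A B x) ∨ (∀ x ≠ 0, pairQuad A B x < 0) := by
  rw [isMaximalDefinite_iff]
  constructor
  · rintro ⟨⟨c, hc⟩, h3⟩
    have hinj : Function.Injective (Fintype.linearCombination ℝ (pairForm b A B)) := by
      rw [← LinearMap.ker_eq_bot, ← Submodule.finrank_eq_zero (R := ℝ)]
      have := LinearMap.finrank_range_add_finrank_ker (Fintype.linearCombination ℝ (pairForm b A B))
      rw [h3, Module.finrank_fin_fun] at this
      omega
    have hx : ∀ x ≠ 0, 0 < 2 * pairQuad A B x * b.det c := by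
      intro x hx
      rw [← wedge22_linearCombination]
      exact hc _ (LinearMap.mem_range_self _ x) (fun h ↦ hx (hinj (h.trans (map_zero _).symm)))
    -- The orientation of the witness `c` relative to `b` decides which sign the quadratic form has.
    rcases lt_or_gt_of_ne (b.isUnit_det c).ne_zero with hd | hd
    · right
      intro x hx0
      by_contra hn
      nlinarith [hx x hx0, mul_nonneg (not_lt.1 hn) (neg_nonneg.2 hd.le)]
    · left
      intro x hx0
      have := hx x hx0
      have h2 := (pos_iff_pos_of_mul_pos this).2 hd
      linarith
  · intro h
    have hne : ∀ x ≠ 0, pairQuad A B x ≠ 0 := fun x hx ↦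
      h.elim (fun h ↦ (h x hx).ne') (fun h ↦ (h x hx).ne)
    refine ⟨?_, ?_⟩
    · obtain ⟨c, hc⟩ : ∃ c : Basis (Fin 4) ℝ E4, ∀ x ≠ 0, 0 < pairQuad A B x * b.det c := by
        rcases h with h | h
        · exact ⟨b, fun x hx ↦ by simpa [b.det_self] using h x hx⟩
        · obtain ⟨c, hc⟩ := exists_basis_neg b
          exact ⟨c, fun x hx ↦ mul_pos_of_neg_of_neg (h x hx) hc⟩
      refine ⟨c, ?_⟩
      rintro _ ⟨x, rfl⟩ hx
      rw [wedge22_linearCombination, mul_assoc]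
      have := hc x (by rintro rfl; exact hx (map_zero _))
      linarith
    · rw [LinearMap.finrank_range_of_inj (injective_of_pairQuad b hne), Module.finrank_fin_fun]

lemma det_ev_pairForm (x : Fin 3 → Fin 3 → ℝ) :
    (Matrix.of fun i j : Fin 3 ↦
      ev (Fintype.linearCombination ℝ (pairForm b A B) (x i)) (b 0) (b j.succ)).det
      = (Matrix.of x).det * (B - A).det := by
  have e : (Matrix.of fun i j : Fin 3 ↦
      ev (Fintype.linearCombination ℝ (pairForm b A B) (x i)) (b 0) (b j.succ))
      = Matrix.of x * (B - A)ᵀ := by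
    ext i j
    simp only [Matrix.of_apply, linearCombination_pairForm, ev_formOf_zero, Matrix.mul_apply,
      Matrix.transpose_apply, Matrix.sub_apply, mulVec, dotProduct]
    rw [← Finset.sum_sub_distrib]
    exact Finset.sum_congr rfl fun k _ ↦ by ring
  rw [e, det_mul, det_transpose]

variable {W : Type*} [AddCommGroup W] [Module ℝ W] {G : LinearMap.BilinForm ℝ W}
  {e : Basis (Fin 3) ℝ W} (he : ∀ i j, G (e i) (e j) = if i = j then 2 else 0)
  {Φ : EndForm W} (hΦ : ∀ u v, Φ.1 u v = soEnd e fun a ↦ ev (pairForm b A B a) u v)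

include hΦ in
-- The Pontrjagin form sees only the trace of the quadratic form. For a definite form the trace
-- carries the sign.
lemma pontrjagin_pair (v : Fin 4 → E4) :
    pontrjagin Φ v = 4 * (∑ a, pairQuad A B (Pi.single a 1)) * b.det v := by
  have h : ∀ a, wedge22 (pairForm b A B a) (pairForm b A B a) v
      = 2 * pairQuad A B (Pi.single a 1) * b.det v := by
    intro a
    rw [← wedge22_linearCombination, linearCombination_single]
  rw [pontrjagin_eq_sum hΦ]
  simp only [h, Fin.sum_univ_three]
  ring

lemma single_one_ne_zero (a : Fin 3) : (Pi.single a 1 : Fin 3 → ℝ) ≠ 0 := by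
  simp

include hΦ in
lemma inducesOrientation_pos (h : ∀ x ≠ 0, 0 < pairQuad A B x) :
    InducesOrientation Φ b.orientation := by
  intro c hc
  rw [pontrjagin_pair b hΦ]
  have h1 : 0 < ∑ a, pairQuad A B (Pi.single a 1) :=
    Finset.sum_pos (fun a _ ↦ h _ (single_one_ne_zero a)) Finset.univ_nonempty
  have h2 := (b.orientation_eq_iff_det_pos c).1 hc.symm
  positivity

include hΦ in
lemma inducesOrientation_neg (h : ∀ x ≠ 0, pairQuad A B x < 0) :
    InducesOrientation Φ (-b.orientation) := by
  intro c hc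
  rw [pontrjagin_pair b hΦ]
  have h1 : ∑ a, pairQuad A B (Pi.single a 1) < 0 :=
    Finset.sum_neg (fun a _ ↦ h _ (single_one_ne_zero a)) Finset.univ_nonempty
  have h2 : b.det c < 0 := by
    refine lt_of_le_of_ne (not_lt.1 fun hp ↦ ?_) (b.isUnit_det c).ne_zero
    have := (b.orientation_eq_iff_det_pos c).2 hp
    rw [hc] at this
    exact Module.Ray.ne_neg_self _ this
  nlinarith [mul_pos_of_neg_of_neg h1 h2]

include he hΦ in
lemma exists_inducesMetric
    (h : (∀ x ≠ 0, 0 < pairQuad A B x) ∨ (∀ x ≠ 0, pairQuad A B x < 0)) :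
    ∃ c, InducesMetric G Φ c := by
  have hm := isMaximalDefinite_iff.1 ((isMaximalDefinite_pair_iff b).2 h)
  obtain ⟨c, hc⟩ := exists_selfDual_eq hm.1 hm.2
  refine ⟨c, ?_, (range_curvatureMap he hΦ).trans hc⟩
  intro c' hc'
  rw [pontrjagin_eq_sum hΦ]
  have hd := (c.orientation_eq_iff_det_pos c').1 hc'.symm
  have hne : ∀ x ≠ 0, pairQuad A B x ≠ 0 := fun x hx ↦
    h.elim (fun h ↦ (h x hx).ne') (fun h ↦ (h x hx).ne)
  refine mul_pos two_pos (Finset.sum_pos (fun a _ ↦ ?_) Finset.univ_nonempty)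
  rw [wedge22_eq_mul_det _ _ c]
  refine mul_pos (wedge22_self_pos c ?_ ?_) hd
  · rw [← hc, ← linearCombination_single (pairForm b A B) a]
    exact LinearMap.mem_range_self _ _
  · intro h0
    rw [← linearCombination_single (pairForm b A B) a] at h0
    exact single_one_ne_zero a (injective_of_pairQuad b hne (h0.trans (map_zero _).symm))

include he hΦ in
-- For every induced metric `c` the orientation factor `c.det b` has the sign of the trace of
-- `pairQuad`, because the Pontrjagin form is positive on `c`. Hence the sign of the volume does not
-- depend on the choice of `c`.
lemma lieVolume_curvatureMap {c : Basis (Fin 4) ℝ E4} (hc : InducesMetric G Φ c) :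
    ∃ k : ℝ, 0 < k ∧ ∀ x : Fin 3 → Fin 3 → ℝ,
      lieVolume c (curvatureMap G Φ (soElt e he (x 0))) (curvatureMap G Φ (soElt e he (x 1)))
        (curvatureMap G Φ (soElt e he (x 2)))
        = k * ((∑ a, pairQuad A B (Pi.single a 1)) * (A - B).det) * (Matrix.of x).det := by
  obtain ⟨k, hk, hl⟩ := exists_lieVolume_eq c b
  have hp := hc.1 c rfl
  rw [pontrjagin_pair b hΦ] at hp
  set q := ∑ a, pairQuad A B (Pi.single a 1) with hq
  have hbc : b.det c * c.det b = 1 := by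
    rw [Basis.det_apply, Basis.det_apply, ← det_mul, Basis.toMatrix_mul_toMatrix_flip, det_one]
  have hqd : 0 < q * b.det c := by linarith
  have hq0 : q ≠ 0 := by
    rintro h0
    simp [h0] at hqd
  have hs : 0 < c.det b / q := by
    -- Since `b.det c` and `c.det b` are inverse, the quotient is the positive number `q * b.det c`
    -- times a square.
    have : c.det b / q = (q * b.det c) * (c.det b / q) ^ 2 := by
      have : (q * b.det c) * (c.det b / q) ^ 2 = (b.det c * c.det b) * (c.det b / q) := by
        field_simp
      rw [this, hbc, one_mul]
    rw [this]
    have hcb := (c.isUnit_det b).ne_zero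
    positivity
  refine ⟨k * (c.det b / q), mul_pos hk hs, fun x ↦ ?_⟩
  have hmem : ∀ i, Fintype.linearCombination ℝ (pairForm b A B) (x i) ∈ selfDual c := by
    intro i
    rw [← hc.2, range_curvatureMap he hΦ]
    exact LinearMap.mem_range_self _ _
  have e1 : (B - A).det = -(A - B).det := by
    rw [← neg_sub, det_neg]
    simp
    ring
  have e2 := hl (fun i ↦ Fintype.linearCombination ℝ (pairForm b A B) (x i)) hmem
  rw [det_ev_pairForm, e1] at e2
  rw [curvatureMap_soElt he hΦ, curvatureMap_soElt he hΦ, curvatureMap_soElt he hΦ, e2]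
  field_simp

include he hΦ in
lemma isPositiveAt_isNegativeAt_iff
    (h : (∀ x ≠ 0, 0 < pairQuad A B x) ∨ (∀ x ≠ 0, pairQuad A B x < 0)) :
    (IsPositiveAt G Φ ↔ 0 < (∑ a, pairQuad A B (Pi.single a 1)) * (A - B).det) ∧
      (IsNegativeAt G Φ ↔ (∑ a, pairQuad A B (Pi.single a 1)) * (A - B).det < 0) := by
  obtain ⟨c₀, hc₀⟩ := exists_inducesMetric b he hΦ h
  set s := (∑ a, pairQuad A B (Pi.single a 1)) * (A - B).det
  -- The standard triple is positive. It tests the sign when a metric is given, and in the converse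
  -- direction every positive triple differs from it by a positive determinant.
  have hone : 0 < soVolume (soElt e he ((1 : Matrix (Fin 3) (Fin 3) ℝ) 0))
      (soElt e he ((1 : Matrix (Fin 3) (Fin 3) ℝ) 1))
      (soElt e he ((1 : Matrix (Fin 3) (Fin 3) ℝ) 2)) := by
    have := soVolume_soElt e he (1 : Matrix (Fin 3) (Fin 3) ℝ)
    rw [this]
    change 0 < 2 * (1 : Matrix (Fin 3) (Fin 3) ℝ).det
    simp
  have hdet : ∀ ξ η ζ : skewAdjointLieSubalgebra G, 0 < soVolume ξ η ζ →
      ∃ x : Fin 3 → Fin 3 → ℝ, ξ = soElt e he (x 0) ∧ η = soElt e he (x 1) ∧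
        ζ = soElt e he (x 2) ∧ 0 < (Matrix.of x).det := by
    intro ξ η ζ hp
    obtain ⟨x, rfl⟩ := exists_soElt e he ξ
    obtain ⟨y, rfl⟩ := exists_soElt e he η
    obtain ⟨z, rfl⟩ := exists_soElt e he ζ
    refine ⟨![x, y, z], rfl, rfl, rfl, ?_⟩
    have := soVolume_soElt e he ![x, y, z]
    simp only [Matrix.cons_val] at this
    rw [this] at hp
    linarith
  refine ⟨⟨?_, ?_⟩, ⟨?_, ?_⟩⟩
  · rintro ⟨c, hc, hp⟩
    obtain ⟨k, hk, hl⟩ := lieVolume_curvatureMap b he hΦ hc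
    have := hp _ _ _ hone
    rw [hl (1 : Matrix (Fin 3) (Fin 3) ℝ)] at this
    change 0 < k * s * (1 : Matrix (Fin 3) (Fin 3) ℝ).det at this
    rw [det_one, mul_one] at this
    exact (mul_pos_iff_of_pos_left hk).1 this
  · intro hs
    refine ⟨c₀, hc₀, fun ξ η ζ hp ↦ ?_⟩
    obtain ⟨k, hk, hl⟩ := lieVolume_curvatureMap b he hΦ hc₀
    obtain ⟨x, rfl, rfl, rfl, hx⟩ := hdet ξ η ζ hp
    rw [hl x]
    positivity
  · rintro ⟨c, hc, hp⟩
    obtain ⟨k, hk, hl⟩ := lieVolume_curvatureMap b he hΦ hc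
    have := hp _ _ _ hone
    rw [hl (1 : Matrix (Fin 3) (Fin 3) ℝ)] at this
    change k * s * (1 : Matrix (Fin 3) (Fin 3) ℝ).det < 0 at this
    rw [det_one, mul_one] at this
    exact neg_of_mul_neg_right this hk.le
  · intro hs
    refine ⟨c₀, hc₀, fun ξ η ζ hp ↦ ?_⟩
    obtain ⟨k, hk, hl⟩ := lieVolume_curvatureMap b he hΦ hc₀
    obtain ⟨x, rfl, rfl, rfl, hx⟩ := hdet ξ η ζ hp
    rw [hl x]
    exact mul_neg_of_neg_of_pos (mul_neg_of_pos_of_neg hk hs) hx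

include he hΦ in
theorem sign_of_pos (h : ∀ x ≠ 0, 0 < pairQuad A B x) :
    A.det ≠ 0 ∧ (IsPositiveAt G Φ ↔ 0 < A.det) ∧ (IsNegativeAt G Φ ↔ A.det < 0) := by
  have hd := det_mul_det_sub_pos (A := A) (B := B) fun x hx ↦ sub_pos.1 (h x hx)
  have hq : 0 < ∑ a, pairQuad A B (Pi.single a 1) :=
    Finset.sum_pos (fun a _ ↦ h _ (single_one_ne_zero a)) Finset.univ_nonempty
  obtain ⟨hp, hn⟩ := isPositiveAt_isNegativeAt_iff b he hΦ (Or.inl h)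
  rw [hp, hn, mul_pos_iff_of_pos_left hq, mul_neg_iff_of_pos hq]
  exact ⟨left_ne_zero_of_mul hd.ne', (pos_iff_pos_of_mul_pos hd).symm,
    (neg_iff_neg_of_mul_pos hd).symm⟩

include he hΦ in
theorem sign_of_neg (h : ∀ x ≠ 0, pairQuad A B x < 0) :
    B.det ≠ 0 ∧ (IsPositiveAt G Φ ↔ 0 < B.det) ∧ (IsNegativeAt G Φ ↔ B.det < 0) := by
  -- The roles of `A` and `B` are exchanged. The negative trace and the sign of a 3 × 3 determinant
  -- under negation then cancel.
  have hd := det_mul_det_sub_pos (A := B) (B := A) fun x hx ↦ sub_neg.1 (h x hx)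
  have hq : ∑ a, pairQuad A B (Pi.single a 1) < 0 :=
    Finset.sum_neg (fun a _ ↦ h _ (single_one_ne_zero a)) Finset.univ_nonempty
  have e1 : (A - B).det = -(B - A).det := by
    rw [← neg_sub, det_neg]
    simp
    ring
  obtain ⟨hp, hn⟩ := isPositiveAt_isNegativeAt_iff b he hΦ (Or.inr h)
  rw [hp, hn, e1, mul_neg, ← neg_mul, mul_pos_iff_of_pos_left (neg_pos.2 hq),
    mul_neg_iff_of_pos (neg_pos.2 hq)]
  exact ⟨left_ne_zero_of_mul hd.ne', (pos_iff_pos_of_mul_pos hd).symm,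
    (neg_iff_neg_of_mul_pos hd).symm⟩

end Pair

/-! ### The blocks of the curvature operator -/

section Blocks

variable {b : Basis (Fin 4) ℝ E4} {R : E4 → E4 → E4 →L[ℝ] E4}

/-- The component `⟨bₖ, R(bᵢ, bⱼ) bₗ⟩`. -/
def riemComp (b : Basis (Fin 4) ℝ E4) (R : E4 → E4 → E4 →L[ℝ] E4) (i j k l : Fin 4) : ℝ :=
  b.coord k (R (b i) (b j) (b l))

/-- The algebraic symmetries of the components of a curvature tensor. -/
structure IsRiemComp (r : Fin 4 → Fin 4 → Fin 4 → Fin 4 → ℝ) : Prop where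
  swap_left : ∀ i j k l, r i j k l = -r j i k l
  swap_right : ∀ i j k l, r i j k l = -r i j l k
  bianchi : ∀ i j k l, r i j k l + r j l k i + r l i k j = 0

/-- The classical octahedron argument: a combination of four Bianchi identities, reduced by the two
skew symmetries. -/
lemma IsRiemComp.pair {r : Fin 4 → Fin 4 → Fin 4 → Fin 4 → ℝ} (h : IsRiemComp r)
    (i j k l : Fin 4) : r i j k l = r k l i j := by
  have b1 := h.bianchi i j k l
  have b2 := h.bianchi j k l i
  have b3 := h.bianchi k l i j
  have b4 := h.bianchi l i j k
  have s1 := h.swap_left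
  have s2 := h.swap_right
  linarith [s1 i j k l, s1 j l k i, s1 l i k j, s1 j k l i, s1 k i l j, s1 i j l k, s1 k l i j,
    s1 l j i k, s1 j k i l, s1 l i j k, s1 i k j l, s1 k l j i,
    s2 i j k l, s2 j l k i, s2 l i k j, s2 j k l i, s2 k i l j, s2 i j l k, s2 k l i j,
    s2 l j i k, s2 j k i l, s2 l i j k, s2 i k j l, s2 k l j i,
    s1 l j k i, s1 i l k j, s1 k j l i,  s1 i k l j, s1 j i k l, s1 l k i j, s1 j l i k, s1 k j i l]

lemma IsCurvatureTensor.isRiemComp {h : E4 →L[ℝ] E4 →L[ℝ] ℝ}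
    (hR : IsCurvatureTensor (fun u v ↦ h u v) R)
    (hb : ∀ i j, h (b i) (b j) = if i = j then 1 else 0) : IsRiemComp (riemComp b R) where
  swap_left i j k l := by
    rw [riemComp, hR.alt]
    simp [riemComp]
  swap_right i j k l := hR.coord_skew b hb _ _ _ _
  bianchi i j k l := by
    have := congrArg (b.coord k) (hR.bianchi (b i) (b j) (b l))
    simp only [map_add, map_zero] at this
    exact this

/-- A curvature tensor with the symmetries has `20` independent components. -/
lemma IsRiemComp.normal {r : Fin 4 → Fin 4 → Fin 4 → Fin 4 → ℝ} (h : IsRiemComp r) :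
    (∀ i k l, r i i k l = 0) ∧ (∀ i j k, r i j k k = 0) ∧
    (∀ k l, r 1 0 k l = -r 0 1 k l) ∧ (∀ k l, r 2 0 k l = -r 0 2 k l) ∧
    (∀ k l, r 3 0 k l = -r 0 3 k l) ∧ (∀ k l, r 2 1 k l = -r 1 2 k l) ∧
    (∀ k l, r 3 1 k l = -r 1 3 k l) ∧ (∀ k l, r 3 2 k l = -r 2 3 k l) ∧
    (∀ k l, r k l 1 0 = -r k l 0 1) ∧ (∀ k l, r k l 2 0 = -r k l 0 2) ∧
    (∀ k l, r k l 3 0 = -r k l 0 3) ∧ (∀ k l, r k l 2 1 = -r k l 1 2) ∧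
    (∀ k l, r k l 3 1 = -r k l 1 3) ∧ (∀ k l, r k l 3 2 = -r k l 2 3) ∧
    r 0 2 0 1 = r 0 1 0 2 ∧ r 0 3 0 1 = r 0 1 0 3 ∧ r 1 2 0 1 = r 0 1 1 2 ∧
    r 1 3 0 1 = r 0 1 1 3 ∧ r 2 3 0 1 = r 0 1 2 3 ∧ r 0 3 0 2 = r 0 2 0 3 ∧
    r 1 2 0 2 = r 0 2 1 2 ∧ r 1 3 0 2 = r 0 2 1 3 ∧ r 2 3 0 2 = r 0 2 2 3 ∧
    r 1 2 0 3 = r 0 3 1 2 ∧ r 1 3 0 3 = r 0 3 1 3 ∧ r 2 3 0 3 = r 0 3 2 3 ∧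
    r 1 3 1 2 = r 1 2 1 3 ∧ r 2 3 1 2 = r 1 2 2 3 ∧ r 2 3 1 3 = r 1 3 2 3 ∧
    r 0 3 1 2 = r 0 2 1 3 - r 0 1 2 3 := by
  refine ⟨fun i k l ↦ ?_, fun i j k ↦ ?_, fun _ _ ↦ h.swap_left _ _ _ _,
    fun _ _ ↦ h.swap_left _ _ _ _, fun _ _ ↦ h.swap_left _ _ _ _, fun _ _ ↦ h.swap_left _ _ _ _,
    fun _ _ ↦ h.swap_left _ _ _ _, fun _ _ ↦ h.swap_left _ _ _ _, fun _ _ ↦ h.swap_right _ _ _ _,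
    fun _ _ ↦ h.swap_right _ _ _ _, fun _ _ ↦ h.swap_right _ _ _ _,
    fun _ _ ↦ h.swap_right _ _ _ _, fun _ _ ↦ h.swap_right _ _ _ _,
    fun _ _ ↦ h.swap_right _ _ _ _, h.pair _ _ _ _, h.pair _ _ _ _, h.pair _ _ _ _,
    h.pair _ _ _ _, h.pair _ _ _ _, h.pair _ _ _ _, h.pair _ _ _ _, h.pair _ _ _ _,
    h.pair _ _ _ _, h.pair _ _ _ _, h.pair _ _ _ _, h.pair _ _ _ _, h.pair _ _ _ _,
    h.pair _ _ _ _, h.pair _ _ _ _, ?_⟩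
  · linarith [h.swap_left i i k l]
  · linarith [h.swap_right i j k k]
  · linarith [h.bianchi 0 3 1 2, h.swap_left 3 2 1 0, h.swap_right 2 3 1 0, h.pair 2 3 0 1,
      h.swap_left 2 0 1 3]

lemma ev_riemOp (hr : IsRiemComp (riemComp b R)) (θ : TwoForm) (m n : Fin 4) :
    ev (riemOp b R θ) (b m) (b n)
      = (1 / 2) * ∑ i, ∑ j, ev θ (b i) (b j) * riemComp b R i j m n := by
  have hsum : ∀ (s : Fin 4 → TwoForm), ev (∑ i, s i) (b m) (b n) = ∑ i, ev (s i) (b m) (b n) := by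
    intro s
    simp only [Fin.sum_univ_four, ev_add]
  change ev (∑ i, ∑ j, ∑ k, ∑ l, ((1 / 4) * ev θ (b i) (b j) * riemComp b R i j k l) •
    cov2 b k l) (b m) (b n) = _
  simp only [hsum, ev_smul, cov2_ev, mul_sub, Finset.sum_sub_distrib, mul_ite, mul_one, mul_zero,
    Finset.sum_ite_eq, Finset.mem_univ, if_true, Finset.mul_sum]
  rw [← Finset.sum_sub_distrib]
  refine Finset.sum_congr rfl fun i _ ↦ ?_
  rw [← Finset.sum_sub_distrib]
  refine Finset.sum_congr rfl fun j _ ↦ ?_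
  simp
  rw [hr.swap_right i j n m]
  ring

lemma ev_ricOp (θ : TwoForm) (m n : Fin 4) :
    ev (ricOp b R θ) (b m) (b n) = (1 / 2) * ∑ j,
      ((ricci b R (b m) (b j) - if m = j then scal b R / 4 else 0) * ev θ (b j) (b n)
        + (ricci b R (b n) (b j) - if n = j then scal b R / 4 else 0) * ev θ (b m) (b j)) := by
  have h1 : ∀ m, ricciZero b R (b m)
      = ∑ j, (ricci b R (b m) (b j) - if m = j then scal b R / 4 else 0) • b j := by
    intro m
    simp [ricciZero, Finsupp.single_apply, Finset.sum_ite_eq]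
  change (1 / 2) * (ev θ (ricciZero b R (b m)) (b n) + ev θ (b m) (ricciZero b R (b n))) = _
  rw [h1, h1]
  simp only [Fin.sum_univ_four, ev_add_left, ev_add_right, ev_smul_left, ev_smul_right]
  ring

lemma ricci_eq (v w : Fin 4) : ricci b R (b v) (b w) = ∑ i, riemComp b R i v i w := rfl

lemma mem_antiSelfDual_of_ev {θ : TwoForm}
    (h1 : ev θ (b 2) (b 3) = -ev θ (b 0) (b 1)) (h2 : ev θ (b 1) (b 3) = ev θ (b 0) (b 2))
    (h3 : ev θ (b 1) (b 2) = -ev θ (b 0) (b 3)) : θ ∈ antiSelfDual b := by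
  rw [mem_antiSelfDual]
  have h4 := ev_swap θ (b 3) (b 1)
  apply ext_basis b <;> simp [hodge, cov2_ev, h1, h2, h3, h4]

lemma ricOp_mem (hr : IsRiemComp (riemComp b R)) {θ : TwoForm} (hθ : θ ∈ selfDual b) :
    ricOp b R θ ∈ antiSelfDual b := by
  obtain ⟨e1, e2, e3⟩ := selfDual_ev b hθ
  have h10 := ev_swap θ (b 1) (b 0)
  have h20 := ev_swap θ (b 2) (b 0)
  have h21 := ev_swap θ (b 2) (b 1)
  have h31 := ev_swap θ (b 3) (b 1)
  have h32 := ev_swap θ (b 3) (b 2)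
  have hn := hr.normal
  apply mem_antiSelfDual_of_ev <;> rw [ev_ricOp, ev_ricOp] <;>
    simp [Fin.sum_univ_four, scal, ricci_eq, ev_self, hn, h10, h20, h21, h31, h32, e1, e2,
      e3] <;> ring

/-- The trace-free Ricci tensor accounts for the whole Λ⁺ → Λ⁻ block of Rm. With `ricOp_mem` this
identifies both blocks. -/
lemma riemOp_sub_ricOp_mem (hr : IsRiemComp (riemComp b R)) {θ : TwoForm} (hθ : θ ∈ selfDual b) :
    riemOp b R θ - ricOp b R θ ∈ selfDual b := by
  obtain ⟨e1, e2, e3⟩ := selfDual_ev b hθ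
  have h10 := ev_swap θ (b 1) (b 0)
  have h20 := ev_swap θ (b 2) (b 0)
  have h30 := ev_swap θ (b 3) (b 0)
  have h21 := ev_swap θ (b 2) (b 1)
  have h31 := ev_swap θ (b 3) (b 1)
  have h32 := ev_swap θ (b 3) (b 2)
  have hn := hr.normal
  apply mem_selfDual_of_ev <;> rw [ev_sub, ev_sub, ev_ricOp, ev_ricOp, ev_riemOp hr, ev_riemOp hr]
    <;> simp [Fin.sum_univ_four, scal, ricci_eq, ev_self, hn, h10, h20, h30, h21, h31, h32, e1, e2,
      e3] <;> ring

lemma projPlus_of_mem_antiSelfDual {θ : TwoForm} (h : θ ∈ antiSelfDual b) : projPlus b θ = 0 := by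
  apply Subtype.ext
  change (1 / 2 : ℝ) • (θ + hodge b θ) = 0
  rw [(mem_antiSelfDual b).1 h, add_neg_cancel, smul_zero]

lemma projMinus_of_mem_selfDual {θ : TwoForm} (h : θ ∈ selfDual b) : projMinus b θ = 0 := by
  apply Subtype.ext
  change (1 / 2 : ℝ) • (θ - hodge b θ) = 0
  rw [(mem_selfDual b).1 h, sub_self, smul_zero]

lemma projPlus_of_mem_selfDual (θ : selfDual b) : projPlus b θ = θ := by
  apply Subtype.ext
  change (1 / 2 : ℝ) • (θ.1 + hodge b θ) = θ
  rw [(mem_selfDual b).1 θ.2, ← two_smul ℝ θ.1, smul_smul]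
  norm_num

lemma projPlus_add_projMinus (θ : TwoForm) :
    (projPlus b θ : TwoForm) + (projMinus b θ : TwoForm) = θ := by
  change (1 / 2 : ℝ) • (θ + hodge b θ) + (1 / 2 : ℝ) • (θ - hodge b θ) = θ
  module

/-- `W⁺ + s/12` is the `Λ⁺ → Λ⁺` block of the curvature operator. -/
lemma weylScal_apply (hr : IsRiemComp (riemComp b R)) (θ : selfDual b) :
    weylScal b R θ = projPlus b (riemOp b R θ) := by
  have h : weylScal b R θ = projPlus b (weylOp b R θ) + (scal b R / 12) • θ := rfl
  have h2 : weylOp b R θ = riemOp b R θ - ricOp b R θ - (scal b R / 12) • (θ : TwoForm) := rfl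
  rw [h, h2, map_sub, map_sub, map_smul, projPlus_of_mem_antiSelfDual (ricOp_mem hr θ.2),
    projPlus_of_mem_selfDual, sub_zero, sub_add_cancel]

/-- `Ric₀` is the `Λ⁺ → Λ⁻` block of the curvature operator. -/
lemma ricPlus_apply (hr : IsRiemComp (riemComp b R)) (θ : selfDual b) :
    ricPlus b R θ = projMinus b (riemOp b R θ) := by
  have h : ricPlus b R θ = projMinus b (ricOp b R θ) := rfl
  have h2 := projMinus_of_mem_selfDual (riemOp_sub_ricOp_mem hr θ.2)
  rw [map_sub, sub_eq_zero] at h2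
  rw [h, h2]

/-- The matrix of `W⁺ + s/12` in the basis `plusBasis`. -/
def weylMatrix (b : Basis (Fin 4) ℝ E4) (R : E4 → E4 → E4 →L[ℝ] E4) : Matrix (Fin 3) (Fin 3) ℝ :=
  LinearMap.toMatrix (plusBasis b) (plusBasis b) (weylScal b R)

lemma weylScal_plusBasis (a : Fin 3) :
    weylScal b R (plusBasis b a) = ∑ c, weylMatrix b R c a • plusBasis b c := by
  rw [weylMatrix, ← (plusBasis b).sum_repr (weylScal b R (plusBasis b a))]
  simp [LinearMap.toMatrix_apply]

lemma ricPlus_plusBasis (a : Fin 3) :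
    ricPlus b R (plusBasis b a) = ∑ c, ricMatrix b R c a • minusBasis b c := by
  rw [ricMatrix, ← (minusBasis b).sum_repr (ricPlus b R (plusBasis b a))]
  simp [LinearMap.toMatrix_apply]

lemma riemOp_plusForm (hr : IsRiemComp (riemComp b R)) (a : Fin 3) :
    riemOp b R (plusForm b a) = pairForm b (weylMatrix b R) (ricMatrix b R) a := by
  rw [← projPlus_add_projMinus (b := b) (riemOp b R (plusForm b a)), ← plusBasis_apply,
    ← weylScal_apply hr, ← ricPlus_apply hr, weylScal_plusBasis, ricPlus_plusBasis]
  simp only [Submodule.coe_sum, Submodule.coe_smul, plusBasis_apply, minusBasis_apply, pairForm,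
    formOf, Matrix.col_apply]

lemma plusBasis_repr (θ : selfDual b) (c : Fin 3) :
    (plusBasis b).repr θ c = -ev θ.1 (b 0) (b c.succ) := by
  fin_cases c <;> rfl

lemma ev_projPlus_zero (θ : TwoForm) :
    ev (projPlus b θ).1 (b 0) (b 1) = (1 / 2) * (ev θ (b 0) (b 1) + ev θ (b 2) (b 3)) ∧
    ev (projPlus b θ).1 (b 0) (b 2) = (1 / 2) * (ev θ (b 0) (b 2) + ev θ (b 3) (b 1)) ∧
    ev (projPlus b θ).1 (b 0) (b 3) = (1 / 2) * (ev θ (b 0) (b 3) + ev θ (b 1) (b 2)) := by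
  have h : (projPlus b θ).1 = (1 / 2 : ℝ) • (θ + hodge b θ) := rfl
  rw [h]
  refine ⟨?_, ?_, ?_⟩ <;> simp [hodge, cov2_ev, mul_add]

/-- Pair symmetry makes the block self-adjoint, and `plusForm` is orthogonal with equal lengths.
Symmetry turns the square in 𝒟 into AᵀA, hence into |A x|². -/
lemma weylMatrix_transpose (hr : IsRiemComp (riemComp b R)) :
    (weylMatrix b R).transpose = weylMatrix b R := by
  have hn := hr.normal
  ext i j
  rw [Matrix.transpose_apply, weylMatrix, LinearMap.toMatrix_apply, LinearMap.toMatrix_apply,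
    plusBasis_repr, plusBasis_repr, weylScal_apply hr, weylScal_apply hr, plusBasis_apply,
    plusBasis_apply]
  have h1 := fun θ : TwoForm ↦ (ev_projPlus_zero (b := b) θ).1
  have h2 := fun θ : TwoForm ↦ (ev_projPlus_zero (b := b) θ).2.1
  have h3 := fun θ : TwoForm ↦ (ev_projPlus_zero (b := b) θ).2.2
  fin_cases i <;> fin_cases j <;>
    simp [h1, h2, h3, ev_riemOp hr, Fin.sum_univ_four, plusForm, cov2_ev, hn] <;> ring

end Blocks

/-! ### The curvature of `Λ⁺` -/

section PlusCurvature

variable {b : Basis (Fin 4) ℝ E4} {R : E4 → E4 → E4 →L[ℝ] E4}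

/-- A skew-adjoint endomorphism acts on `Λ⁺` through its self-dual part. -/
lemma projPlus_act_eq_soEnd {S : E4 →L[ℝ] E4}
    (hS : ∀ k l, b.coord k (S (b l)) = -b.coord l (S (b k))) (θ : selfDual b) :
    projPlus b (-act S θ.1) = soEnd (plusBasis b)
      ![-(b.coord 0 (S (b 1)) + b.coord 2 (S (b 3))), -(b.coord 0 (S (b 2)) + b.coord 3 (S (b 1))),
        -(b.coord 0 (S (b 3)) + b.coord 1 (S (b 2)))] θ := by
  obtain ⟨σ, hσ⟩ : ∃ σ : Fin 4 → Fin 4 → ℝ, ∀ k l, b.coord k (S (b l)) = σ k l := ⟨_, fun _ _ ↦ rfl⟩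
  have hact : ∀ θ m n, ev (act S θ) (b m) (b n) = ∑ k, (σ k m * ev θ (b k) (b n)
      + σ k n * ev θ (b m) (b k)) := by
    intro θ m n
    have hSb : ∀ m, S (b m) = ∑ k, σ k m • b k := fun m ↦ by
      simp only [← hσ]
      exact (b.sum_repr _).symm
    rw [act_ev, hSb m, hSb n]
    simp only [Fin.sum_univ_four, ev_add_left, ev_add_right, ev_smul_left, ev_smul_right]
    ring
  simp only [hσ] at hS ⊢
  have h00 : ∀ k, σ k k = 0 := fun k ↦ by linarith [hS k k]
  have hlin : projPlus b ∘ₗ (-(act S).toLinearMap) ∘ₗ (selfDual b).subtype = soEnd (plusBasis b)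
      ![-(σ 0 1 + σ 2 3), -(σ 0 2 + σ 3 1), -(σ 0 3 + σ 1 2)] := by
    refine (plusBasis b).ext fun a ↦ (plusBasis b).ext_elem fun c ↦ ?_
    have h1 := fun θ : TwoForm ↦ (ev_projPlus_zero (b := b) θ).1
    have h2 := fun θ : TwoForm ↦ (ev_projPlus_zero (b := b) θ).2.1
    have h3 := fun θ : TwoForm ↦ (ev_projPlus_zero (b := b) θ).2.2
    have hl : (projPlus b ∘ₗ (-(act S).toLinearMap) ∘ₗ (selfDual b).subtype) (plusBasis b a)
      = projPlus b (-act S (plusForm b a)) := by rw [← plusBasis_apply]; rfl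
    have hc : ∀ f : Fin 3 → ℝ, (plusBasis b).repr (∑ c, f c • plusBasis b c) c = f c := by
      intro f
      simp [Finsupp.single_apply]
    rw [hl, plusBasis_repr, soEnd_apply, hc]
    fin_cases a <;> fin_cases c <;>
      simp [h1, h2, h3, hact, Fin.sum_univ_four, plusForm, cov2_ev, crossMatrix, h00, hS 1 0,
        hS 2 0, hS 3 0, hS 2 1, hS 3 1, hS 3 2] <;> ring
  exact LinearMap.congr_fun hlin θ

end PlusCurvature

/-! ### The curvature of `Λ⁺` in terms of `W⁺ + s/12` and `Ric₀` -/

section LambdaPlus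

variable {b : Basis (Fin 4) ℝ E4} {R : E4 → E4 → E4 →L[ℝ] E4}

lemma formInner_plusForm (i j : Fin 3) :
    formInner b (plusForm b i) (plusForm b j) = if i = j then 2 else 0 := by
  rw [formInner_apply]
  fin_cases i <;> fin_cases j <;> simp [Fin.sum_univ_four, plusForm, cov2_ev] <;> norm_num

lemma formInner_plusBasis (x y : Fin 3 → ℝ) :
    formInner b (∑ i, x i • plusBasis b i : selfDual b) (∑ i, y i • plusBasis b i : selfDual b)
      = 2 * (x ⬝ᵥ y) := by
  simp only [Submodule.coe_sum, Submodule.coe_smul, plusBasis_apply, map_sum, map_smul,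
    LinearMap.sum_apply, LinearMap.smul_apply, formInner_plusForm, smul_eq_mul, dotProduct]
  simp [Fin.sum_univ_three]
  ring

/-- The curvature operator in terms of the curvature tensor, on a basis of `Λ⁺`. -/
lemma ev_riemOp_plusForm {h : E4 →L[ℝ] E4 →L[ℝ] ℝ}
    (hR : IsCurvatureTensor (fun u v ↦ h u v) R) (hr : IsRiemComp (riemComp b R))
    (a : Fin 3) (u v : E4) : ev (riemOp b R (plusForm b a)) u v =
      ![-(b.coord 0 (R u v (b 1)) + b.coord 2 (R u v (b 3))),
        -(b.coord 0 (R u v (b 2)) + b.coord 3 (R u v (b 1))),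
        -(b.coord 0 (R u v (b 3)) + b.coord 1 (R u v (b 2)))] a := by
  -- `R` is a bare function of `u`, `v`. Its bilinearity comes from `hR` and reduces the identity to
  -- basis vectors.
  let L : E4 →ₗ[ℝ] E4 →ₗ[ℝ] E4 →L[ℝ] E4 := LinearMap.mk₂ ℝ R hR.add_left hR.smul_left
    (fun u v v' ↦ by rw [hR.alt, hR.add_left, hR.alt u v, hR.alt u v', neg_add])
    (fun c u v ↦ by rw [hR.alt, hR.smul_left, hR.alt u v, smul_neg])
  let ℓ : Fin 4 → Fin 4 → (E4 →L[ℝ] E4) →ₗ[ℝ] ℝ := fun k l ↦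
    b.coord k ∘ₗ (ContinuousLinearMap.apply ℝ E4 (b l)).toLinearMap
  let Y : Fin 3 → (E4 →L[ℝ] E4) →ₗ[ℝ] ℝ := ![-(ℓ 0 1 + ℓ 2 3), -(ℓ 0 2 + ℓ 3 1), -(ℓ 0 3 + ℓ 1 2)]
  have hY : ∀ a S, Y a S = ![-(b.coord 0 (S (b 1)) + b.coord 2 (S (b 3))),
        -(b.coord 0 (S (b 2)) + b.coord 3 (S (b 1))),
        -(b.coord 0 (S (b 3)) + b.coord 1 (S (b 2)))] a := by
    intro a S
    fin_cases a <;> rfl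
  have hL : toBilin (riemOp b R (plusForm b a)) = L.compr₂ (Y a) := by
    refine LinearMap.ext_basis b b fun m n ↦ ?_
    change ev (riemOp b R (plusForm b a)) (b m) (b n) = Y a (R (b m) (b n))
    rw [hY, ev_riemOp hr]
    change _ = ![-(riemComp b R m n 0 1 + riemComp b R m n 2 3),
      -(riemComp b R m n 0 2 + riemComp b R m n 3 1),
      -(riemComp b R m n 0 3 + riemComp b R m n 1 2)] a
    -- Pair symmetry turns the self-dual part of the endomorphism R(u, v) into Rm of a self-dual
    -- form, evaluated on (u, v).
    rw [hr.pair m n 0 1, hr.pair m n 2 3, hr.pair m n 0 2, hr.pair m n 3 1, hr.pair m n 0 3,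
      hr.pair m n 1 2]
    fin_cases a <;> simp [Fin.sum_univ_four, plusForm, cov2_ev, hr.swap_left 1 0,
      hr.swap_left 2 0, hr.swap_left 3 0, hr.swap_left 3 2, hr.swap_left 2 1, hr.swap_left 3 1]
      <;> ring
  have := LinearMap.congr_fun₂ hL u v
  rw [← hY]
  exact this

lemma toLin_sub {V W : Type*} [AddCommGroup V] [Module ℝ V] [AddCommGroup W] [Module ℝ W]
    (e : Basis (Fin 3) ℝ V) (f : Basis (Fin 3) ℝ W) (X Y : Matrix (Fin 3) (Fin 3) ℝ) :
    Matrix.toLin e f (X - Y) = Matrix.toLin e f X - Matrix.toLin e f Y :=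
  map_sub _ _ _

lemma formInner_opD (hr : IsRiemComp (riemComp b R)) (x : Fin 3 → ℝ) :
    formInner b (opD b R (∑ i, x i • plusBasis b i)) (∑ i, x i • plusBasis b i : selfDual b)
      = 2 * pairQuad (weylMatrix b R) (ricMatrix b R) x := by
  set A := weylMatrix b R with hA
  set B := ricMatrix b R with hB
  have h1 : weylScal b R = Matrix.toLin (plusBasis b) (plusBasis b) A := by
    rw [hA, weylMatrix, Matrix.toLin_toMatrix]
  have h2 : ricPlus b R = Matrix.toLin (plusBasis b) (minusBasis b) B := by
    rw [hB, ricMatrix, Matrix.toLin_toMatrix]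
  have h3 : opD b R = Matrix.toLin (plusBasis b) (plusBasis b)
      (A.transpose * A - B.transpose * B) := by
    rw [opD, ricAdjoint, ← hB, h1, h2, toLin_sub,
      Matrix.toLin_mul (plusBasis b) (plusBasis b) (plusBasis b),
      Matrix.toLin_mul (plusBasis b) (minusBasis b) (plusBasis b), hA, weylMatrix_transpose hr,
      pow_two]
    rfl
  have h4 : opD b R (∑ i, x i • plusBasis b i)
      = ∑ i, ((A.transpose * A - B.transpose * B).mulVec x) i • plusBasis b i := by
    rw [h3, Matrix.toLin_apply]
    refine Finset.sum_congr rfl fun i _ ↦ ?_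
    congr 2
    exact (plusBasis b).repr_sum_self x
  have h5 : ∀ N : Matrix (Fin 3) (Fin 3) ℝ,
      (N.transpose * N).mulVec x ⬝ᵥ x = N.mulVec x ⬝ᵥ N.mulVec x := by
    intro N
    rw [← Matrix.mulVec_mulVec, dotProduct_comm, Matrix.dotProduct_mulVec, Matrix.vecMul_transpose]
  rw [h4, formInner_plusBasis, pairQuad, Matrix.sub_mulVec, sub_dotProduct, h5, h5]

lemma forall_plus_iff {P : selfDual b → Prop} :
    (∀ α : selfDual b, α ≠ 0 → P α) ↔ ∀ x : Fin 3 → ℝ, x ≠ 0 → P (∑ i, x i • plusBasis b i) := by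
  have hx : ∀ y : Fin 3 → ℝ, (∑ i, y i • plusBasis b i) = (plusBasis b).equivFun.symm y :=
    fun y ↦ ((plusBasis b).equivFun_symm_apply y).symm
  simp only [hx]
  constructor
  · intro h x hx0
    exact h _ (fun h0 ↦ hx0 ((LinearEquiv.map_eq_zero_iff _).1 h0))
  · intro h α hα
    have := h ((plusBasis b).equivFun α) fun h0 ↦ hα ((LinearEquiv.map_eq_zero_iff _).1 h0)
    simpa only [LinearEquiv.symm_apply_apply] using this

lemma isPosDef_opD_iff (hr : IsRiemComp (riemComp b R)) :
    IsPosDef (opD b R) ↔ ∀ x ≠ 0, 0 < pairQuad (weylMatrix b R) (ricMatrix b R) x := by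
  rw [IsPosDef, forall_plus_iff]
  refine forall₂_congr fun x _ ↦ ?_
  rw [formInner_opD hr]
  constructor <;> intro h <;> linarith

lemma isNegDef_opD_iff (hr : IsRiemComp (riemComp b R)) :
    IsNegDef (opD b R) ↔ ∀ x ≠ 0, pairQuad (weylMatrix b R) (ricMatrix b R) x < 0 := by
  rw [IsNegDef, forall_plus_iff]
  refine forall₂_congr fun x _ ↦ ?_
  rw [formInner_opD hr]
  constructor <;> intro h <;> linarith

variable {M : Type*} [TopologicalSpace M] [ChartedSpace E4 M]
  [IsManifold (𝓡 4) ((⊤ : ℕ∞) : WithTop ℕ∞) M]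
  [RiemannianBundle (fun x : M ↦ TangentSpace (𝓡 4) x)]

lemma plusInner_plusBasis (o : ManifoldOrientation M) (x : M) (i j : Fin 3) :
    plusInner o x (plusBasis (frame o x) i) (plusBasis (frame o x) j) = if i = j then 2 else 0 := by
  rw [← formInner_plusForm (b := frame o x), ← plusBasis_apply, ← plusBasis_apply]
  rfl

variable [IsContMDiffRiemannianBundle (𝓡 4) ((⊤ : ℕ∞) : WithTop ℕ∞) E4
  (fun x : M ↦ TangentSpace (𝓡 4) x)]

lemma isRiemComp_riemann (o : ManifoldOrientation M) (x : M) :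
    IsRiemComp (riemComp (frame o x) (riemann x)) :=
  (isCurvatureTensor_riemann x).isRiemComp (chartMetric_frame o x)

/-- This puts the geometric curvature in the form required by the results on pairs of matrices. All
later steps are linear algebra with `weylMatrix` and `ricMatrix`. -/
lemma plusCurvature_eq_soEnd (o : ManifoldOrientation M) (x : M) (u v : E4) :
    (plusCurvature o x).1 u v = soEnd (plusBasis (frame o x)) fun a ↦
      ev (pairForm (frame o x) (weylMatrix (frame o x) (riemann x))
        (ricMatrix (frame o x) (riemann x)) a) u v := by
  have hR := isCurvatureTensor_riemann x
  have hr := isRiemComp_riemann o x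
  refine LinearMap.ext fun θ ↦ ?_
  rw [plusCurvature_apply, projPlus_act_eq_soEnd (hR.coord_skew _ (chartMetric_frame o x) u v)]
  congr 2
  funext a
  rw [← riemOp_plusForm hr, ev_riemOp_plusForm hR hr]

lemma lambdaPlusDefiniteAt_iff (o : ManifoldOrientation M) (x : M) :
    LambdaPlusDefiniteAt o x ↔ IsPosDef (opDAt o x) ∨ IsNegDef (opDAt o x) := by
  have hr := isRiemComp_riemann o x
  rw [opDAt, isPosDef_opD_iff hr, isNegDef_opD_iff hr, LambdaPlusDefiniteAt, IsDefiniteAt,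
    range_curvatureMap (plusInner_plusBasis o x) (plusCurvature_eq_soEnd o x),
    isMaximalDefinite_pair_iff]

end LambdaPlus

end

end DefConn

theorem mainTheorem4 {M : Type*} [TopologicalSpace M] [ChartedSpace DefConn.E4 M]
    [IsManifold (𝓡 4) ((⊤ : ℕ∞) : WithTop ℕ∞) M]
    [RiemannianBundle (fun x : M ↦ TangentSpace (𝓡 4) x)]
    [IsContMDiffRiemannianBundle (𝓡 4) ((⊤ : ℕ∞) : WithTop ℕ∞) DefConn.E4
      (fun x : M ↦ TangentSpace (𝓡 4) x)]
    (o : DefConn.ManifoldOrientation M) :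
    (DefConn.LambdaPlusDefinite o ↔
      ∀ x, DefConn.IsPosDef (DefConn.opDAt o x) ∨ DefConn.IsNegDef (DefConn.opDAt o x)) ∧
    (∀ x, DefConn.LambdaPlusDefiniteAt o x ↔
      DefConn.IsPosDef (DefConn.opDAt o x) ∨ DefConn.IsNegDef (DefConn.opDAt o x)) ∧
    (∀ x, DefConn.IsPosDef (DefConn.opDAt o x) →
      DefConn.LambdaPlusInduces o x (o.orient x) ∧
      (DefConn.weylScalAt o x).det ≠ 0 ∧
      (DefConn.LambdaPlusPositiveAt o x ↔ 0 < (DefConn.weylScalAt o x).det) ∧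
      (DefConn.LambdaPlusNegativeAt o x ↔ (DefConn.weylScalAt o x).det < 0)) ∧
    (∀ x, DefConn.IsNegDef (DefConn.opDAt o x) →
      DefConn.LambdaPlusInduces o x (-o.orient x) ∧
      DefConn.detRicAt o x ≠ 0 ∧
      (DefConn.LambdaPlusPositiveAt o x ↔ 0 < DefConn.detRicAt o x) ∧
      (DefConn.LambdaPlusNegativeAt o x ↔ DefConn.detRicAt o x < 0)) := by
  refine ⟨forall_congr' fun x ↦ DefConn.lambdaPlusDefiniteAt_iff o x,
    fun x ↦ DefConn.lambdaPlusDefiniteAt_iff o x, fun x h ↦ ?_, fun x h ↦ ?_⟩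
  · have hq := (DefConn.isPosDef_opD_iff (DefConn.isRiemComp_riemann o x)).1 h
    refine ⟨?_, ?_⟩
    · rw [DefConn.LambdaPlusInduces, ← DefConn.frame_orientation]
      exact DefConn.inducesOrientation_pos _ (DefConn.plusCurvature_eq_soEnd o x) hq
    · have hs := DefConn.sign_of_pos _ (DefConn.plusInner_plusBasis o x)
        (DefConn.plusCurvature_eq_soEnd o x) hq
      -- The matrix determinant is passed to the basis-free determinant of the endomorphism. For
      -- Ric₀ no such step is needed, since `detRic` is defined by its matrix.
      rw [DefConn.weylMatrix, LinearMap.det_toMatrix] at hs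
      exact hs
  · have hq := (DefConn.isNegDef_opD_iff (DefConn.isRiemComp_riemann o x)).1 h
    refine ⟨?_, DefConn.sign_of_neg _ (DefConn.plusInner_plusBasis o x)
      (DefConn.plusCurvature_eq_soEnd o x) hq⟩
    rw [DefConn.LambdaPlusInduces, Orientation.map_neg, ← DefConn.frame_orientation]
    exact DefConn.inducesOrientation_neg _ (DefConn.plusCurvature_eq_soEnd o x) hq
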